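/- **Setting.** Let $\alpha,\beta,\gamma,\delta\in(0,\pi)$ be the sector angles of a spherical 4-bar linkage, i.e. $\alpha<\beta+\gamma+\delta<\alpha+2\pi$, $\beta<\gamma+\delta+\alpha<\beta+2\pi$, $\gamma<\delta+\alpha+\beta<\gamma+2\pi$, $\delta<\alpha+\beta+\gamma<\delta+2\pi$, and put $\sigma=\frac12(\alpha+\beta+\gamma+\delta)$. For complex $x,y,z$ (half-angle tangents of the folding angles) let $$f(\alpha,\beta,\gamma,\delta;x,y)=f_{22}x^2y^2+f_{20}x^2-2\sin\alpha\sin\gamma\,xy+f_{02}y^2+f_{00},$$ $$f_{22}=\sin(\sigma-\beta)\sin(\sigma-\beta-\delta),\quad f_{20}=\sin(\sigma-\alpha)\sin(\sigma-\alpha-\delta),\quad f_{02}=\sin(\sigma-\gamma)\sin(\sigma-\gamma-\delta),\quad f_{00}=\sin\sigma\sin(\sigma-\delta),$$ $$g(x,z)=\sin(\sigma-\alpha-\delta)\sin(\sigma-\beta-\delta)\,x^2z^2+\sin(\sigma-\alpha)\sin(\sigma-\beta)\,x^2-\sin(\sigma-\gamma)\sin(\sigma-\delta)\,z^2+\sin\sigma\sin(\sigma-\alpha-\beta).$$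 Thus $f(\alpha,\beta,\gamma,\delta;x,y)=0$ is the relation between the adjacent folding angles $x,y$; $f(\delta,\alpha,\beta,\gamma;w,x)=f(\beta,\alpha,\delta,\gamma;x,w)=0$ is the one between $x,w$; and $g(x,z)=0$ is the one between the opposite folding angles $x,z$. Assume the *elliptic* type: $f_{22},f_{20},f_{02},f_{00}$ are all nonzero. Let $$M=\frac{\sin\alpha\sin\beta\sin\gamma\sin\delta}{\sin(\sigma-\alpha)\sin(\sigma-\beta)\sin(\sigma-\gamma)\sin(\sigma-\delta)},$$ $$p_x=\sqrt{\tfrac{\sin\alpha\sin\beta}{\sin(\sigma-\alpha)\sin(\sigma-\beta)}-1},\quad p_y=\sqrt{\tfrac{\sin\beta\sin\gamma}{\sin(\sigma-\beta)\sin(\sigma-\gamma)}-1},\quad p_z=\sqrt{\tfrac{\sin\gamma\sin\delta}{\sin(\sigma-\gamma)\sin(\sigma-\delta)}-1},\quad p_w=\sqrt{\tfrac{\sin\delta\sin\alpha}{\sin(\sigma-\delta)\sin(\sigma-\alpha)}-1},$$ where $\sqrt a=i\sqrt{-a}$ for $a<0$. The normalized opposite and adjacent equations are $$(\mathrm O)\quad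 (M-1)\frac{x^2z^2}{p_x^2p_z^2}+\frac{x^2}{p_x^2}+\frac{z^2}{p_z^2}-1=0,$$ $$(\mathrm A)\quad (Q-1)\frac{x^2y^2}{p_x^2p_y^2}+\frac{x^2}{p_x^2}+\frac{y^2}{p_y^2}+C-2B\,\frac{xy}{p_xp_y}=0,$$ with $E=\sin(\sigma-\alpha)\sin(\sigma-\gamma)-\sin\beta\sin\delta$ and $$Q=\frac{\sin\alpha\sin\gamma}{\sin(\sigma-\alpha)\sin(\sigma-\gamma)},\qquad C=\frac{\sin(\sigma-\beta)\sin(\sigma-\delta)}{E},\qquad B=\frac{\sin\alpha\sin\gamma}{\sqrt{\sin(\sigma-\alpha)\sin(\sigma-\gamma)\,E}} .$$ Let $\varepsilon=1$ if $\gamma+\delta<\sigma$ and $\varepsilon=-1$ otherwise. (When $p_x,p_y$ are both real, $\varepsilon$ is the sign of $\pi-\sigma$; when both are imaginary, it is the opposite sign.) For $0<k<1$ let $\mathrm{sn},\mathrm{cn},\mathrm{dn}$ be the Jacobi elliptic functions of modulus $k$ on $\mathbb C$ (they have the same poles), $k'=\sqrt{1-k^2}$, $K=\int_0^{\pi/2}\frac{d\psi}{\sqrt{1-k^2\sin^2\psi}}$,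 $K'=K(k')$, and $(0,iK')=\{is:0<s<K'\}$. An equation $\Phi(u,v)=0$ is said to be *parametrized by* $u=a\varphi(t)$, $v=b\varphi(t+s)$ if its solutions $(u,v)\in\mathbb C^2$ are exactly the points $(a\varphi(t),b\varphi(t+s))$ with $t\in\mathbb C$ such that neither $t$ nor $t+s$ is a pole. **Proposition.** $M\in(0,1)\cup(1,\infty)$. All identities below hold whenever none of the arguments that occur in them is a pole (and, in 3, $\mathrm{dn}\,\theta\ne0$). 1. Let $M>1$ and $k=\sqrt{1-1/M}$. Then $\frac{k^2}{1-k^2}\mathrm{cn}^2t\,\mathrm{cn}^2(t+K)+\mathrm{cn}^2t+\mathrm{cn}^2(t+K)-1=0$ for all $t\in\mathbb C$, and (O), as well as $g(x,z)=0$, is parametrized by $x=p_x\,\mathrm{cn}\,t$, $z=p_z\,\mathrm{cn}(t+K)$. 2. Let $0<M<1$ and $k=\sqrt{1-M}$. Then $-k^2\mathrm{sn}^2t\,\mathrm{sn}^2(t+K)+\mathrm{sn}^2t+\mathrm{sn}^2(t+K)-1=0$ for all $t\in\mathbb C$, and (O), as well as $g(x,z)=0$, is parametrized by $x=p_x\,\mathrm{sn}\,t$,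 $z=p_z\,\mathrm{sn}(t+K)$. 3. Let $M>1$ and $k=\sqrt{1-1/M}$. For all $t,\theta\in\mathbb C$, $$\frac{k^2\mathrm{sn}^2\theta}{\mathrm{dn}^2\theta}\mathrm{cn}^2t\,\mathrm{cn}^2(t-\theta)+\mathrm{cn}^2t-\frac{2\,\mathrm{cn}\,\theta}{\mathrm{dn}^2\theta}\mathrm{cn}\,t\,\mathrm{cn}(t-\theta)+\mathrm{cn}^2(t-\theta)+\frac{(k^2-1)\mathrm{sn}^2\theta}{\mathrm{dn}^2\theta}=0 .$$ Suppose $\sigma<\pi$ and $\alpha+\gamma<\sigma$, or $\sigma>\pi$ and $\alpha+\gamma>\sigma$. There is exactly one $\theta_1\in(0,iK')$ with $$\mathrm{dn}\,\theta_1=\sqrt{\frac{\sin(\sigma-\alpha)\sin(\sigma-\gamma)}{\sin\alpha\sin\gamma}},$$ and for $\theta\in(0,iK')$ this equation is equivalent to the system $$\frac{k^2\mathrm{sn}^2\theta}{\mathrm{dn}^2\theta}=Q-1,\qquad \frac{\mathrm{cn}\,\theta}{\mathrm{dn}^2\theta}=B,\qquad \frac{(k^2-1)\mathrm{sn}^2\theta}{\mathrm{dn}^2\theta}=C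 .$$ Equation (A) is parametrized by $x=p_x\,\mathrm{cn}\,t$, $y=p_y\,\mathrm{cn}(t-\theta_1)$, and $f(\alpha,\beta,\gamma,\delta;x,y)=0$ is parametrized by $x=p_x\,\mathrm{cn}\,t$, $y=\varepsilon p_y\,\mathrm{cn}(t-\theta_1)$. If instead $\sigma<\pi$ and $\alpha+\gamma>\sigma$, or $\sigma>\pi$ and $\alpha+\gamma<\sigma$, all these assertions hold after the replacement $(\alpha,\beta,\gamma,\delta,x,y,z,w)\to(\delta,\alpha,\beta,\gamma,w,x,y,z)$ (in $Q,B,C,E,\varepsilon$, (A), $f$ and the amplitudes, so that $p_x,p_y$ become $p_w,p_x$); in particular $$\mathrm{dn}\,\theta_1=\sqrt{\frac{\sin(\sigma-\beta)\sin(\sigma-\delta)}{\sin\beta\sin\delta}} .$$ 4. Let $0<M<1$ and $k=\sqrt{1-M}$. For all $t,\theta\in\mathbb C$, $$-k^2\mathrm{sn}^2\theta\,\mathrm{sn}^2t\,\mathrm{sn}^2(t-\theta)+\mathrm{sn}^2t-2\,\mathrm{cn}\,\theta\,\mathrm{dn}\,\theta\,\mathrm{sn}\,t\,\mathrm{sn}(t-\theta)+\mathrm{sn}^2(t-\theta)-\mathrm{sn}^2\theta=0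 .$$ Suppose $\sigma<\pi$ and $\alpha+\gamma>\sigma$, or $\sigma>\pi$ and $\alpha+\gamma<\sigma$. There is exactly one $\theta_1\in(0,iK')$ with $$\mathrm{dn}\,\theta_1=\sqrt{\frac{\sin\alpha\sin\gamma}{\sin(\sigma-\alpha)\sin(\sigma-\gamma)}},$$ and for $\theta\in(0,iK')$ this equation is equivalent to the system $$-k^2\mathrm{sn}^2\theta=Q-1,\qquad \mathrm{cn}\,\theta\,\mathrm{dn}\,\theta=B,\qquad -\mathrm{sn}^2\theta=C .$$ Equation (A) is parametrized by $x=p_x\,\mathrm{sn}\,t$, $y=p_y\,\mathrm{sn}(t-\theta_1)$, and $f(\alpha,\beta,\gamma,\delta;x,y)=0$ is parametrized by $x=p_x\,\mathrm{sn}\,t$, $y=\varepsilon p_y\,\mathrm{sn}(t-\theta_1)$. If instead $\sigma<\pi$ and $\alpha+\gamma<\sigma$, or $\sigma>\pi$ and $\alpha+\gamma>\sigma$, all these assertions hold after the replacement described in 3; in particular $$\mathrm{dn}\,\theta_1=\sqrt{\frac{\sin\beta\sin\delta}{\sin(\sigma-\beta)\sin(\sigma-\delta)}} .$$ -/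

import Mathlib

open Real Set

noncomputable section

namespace SphericalLinkage

/-! ### Jacobi elliptic functions -/

/-- The incomplete elliptic integral of the first kind `∫₀^φ dψ / √(1 - k² sin² ψ)`. -/
def ellipticF (k φ : ℝ) : ℝ :=
  ∫ ψ in (0 : ℝ)..φ, 1 / √(1 - k ^ 2 * Real.sin ψ ^ 2)

/-- The quarter period `K(k)`. -/
def quarterPeriod (k : ℝ) : ℝ := ellipticF k (π / 2)

/-- The complementary modulus `k' = √(1 - k²)`. -/
def complModulus (k : ℝ) : ℝ := √(1 - k ^ 2)

/-- The amplitude, i.e. the inverse function of `φ ↦ ellipticF k φ`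
(a bijection of `ℝ` onto itself for `0 ≤ k < 1`). -/
def am (k x : ℝ) : ℝ := Function.invFun (ellipticF k) x

def snReal (k x : ℝ) : ℝ := Real.sin (am k x)

def cnReal (k x : ℝ) : ℝ := Real.cos (am k x)

def dnReal (k x : ℝ) : ℝ := √(1 - k ^ 2 * Real.sin (am k x) ^ 2)

/-- Common denominator of `sn`, `cn`, `dn` at `t = x + i y`: the addition formulas for
`x + i y`, together with `sn(iy;k) = i sn(y;k')/cn(y;k')`, `cn(iy;k) = 1/cn(y;k')` and
`dn(iy;k) = dn(y;k')/cn(y;k')`, are written with numerator and denominator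
multiplied by `cn(y;k')²`. -/
def jacobiDen (k : ℝ) (t : ℂ) : ℝ :=
  cnReal (complModulus k) t.im ^ 2 + k ^ 2 * snReal k t.re ^ 2 * snReal (complModulus k) t.im ^ 2

/-- The common poles of `sn`, `cn`, `dn`. -/
def IsPole (k : ℝ) (t : ℂ) : Prop := jacobiDen k t = 0

/-- The Jacobi function `sn(t; k)` of a complex argument (away from its poles). -/
def sn (k : ℝ) (t : ℂ) : ℂ :=
  ((snReal k t.re * dnReal (complModulus k) t.im : ℝ)
    + Complex.I * (cnReal k t.re * dnReal k t.re * snReal (complModulus k) t.im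
        * cnReal (complModulus k) t.im : ℝ)) / (jacobiDen k t : ℝ)

/-- The Jacobi function `cn(t; k)` of a complex argument (away from its poles). -/
def cn (k : ℝ) (t : ℂ) : ℂ :=
  ((cnReal k t.re * cnReal (complModulus k) t.im : ℝ)
    - Complex.I * (snReal k t.re * dnReal k t.re * snReal (complModulus k) t.im
        * dnReal (complModulus k) t.im : ℝ)) / (jacobiDen k t : ℝ)

/-- The Jacobi function `dn(t; k)` of a complex argument (away from its poles). -/
def dn (k : ℝ) (t : ℂ) : ℂ :=
  ((dnReal k t.re * cnReal (complModulus k) t.im * dnReal (complModulus k) t.im : ℝ)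
    - Complex.I * (k ^ 2 * snReal k t.re * cnReal k t.re
        * snReal (complModulus k) t.im : ℝ)) / (jacobiDen k t : ℝ)

/-- The open segment `(0, iK')` of the imaginary axis, `K' = K(k')`. -/
def imagSegment (k : ℝ) : Set ℂ :=
  {θ | ∃ s ∈ Ioo (0 : ℝ) (quarterPeriod (complModulus k)), θ = s * Complex.I}

/-! ### Spherical four-bar linkages -/

/-- Semi-perimeter. -/
def semi (α β γ δ : ℝ) : ℝ := (α + β + γ + δ) / 2

/-- The admissible sector angles of a spherical four-bar linkage. -/
structure IsSectorAngles (α β γ δ : ℝ) : Prop where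
  mem_α : α ∈ Ioo 0 π
  mem_β : β ∈ Ioo 0 π
  mem_γ : γ ∈ Ioo 0 π
  mem_δ : δ ∈ Ioo 0 π
  lt_α : α < β + γ + δ ∧ β + γ + δ < α + 2 * π
  lt_β : β < γ + δ + α ∧ γ + δ + α < β + 2 * π
  lt_γ : γ < δ + α + β ∧ δ + α + β < γ + 2 * π
  lt_δ : δ < α + β + γ ∧ α + β + γ < δ + 2 * π

def f22 (α β γ δ : ℝ) : ℝ := sin (semi α β γ δ - β) * sin (semi α β γ δ - β - δ)
def f20 (α β γ δ : ℝ) : ℝ := sin (semi α β γ δ - α) * sin (semi α β γ δ - α - δ)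
def f11 (α γ : ℝ) : ℝ := -(sin α * sin γ)
def f02 (α β γ δ : ℝ) : ℝ := sin (semi α β γ δ - γ) * sin (semi α β γ δ - γ - δ)
def f00 (α β γ δ : ℝ) : ℝ := sin (semi α β γ δ) * sin (semi α β γ δ - δ)

/-- The polynomial relating the half-angle tangents `x`, `y` of adjacent folding angles. -/
def adjacentPoly (α β γ δ : ℝ) (x y : ℂ) : ℂ :=
  f22 α β γ δ * x ^ 2 * y ^ 2 + f20 α β γ δ * x ^ 2 + 2 * f11 α γ * x * y
    + f02 α β γ δ * y ^ 2 + f00 α β γ δ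

/-- The elliptic type. -/
def IsElliptic (α β γ δ : ℝ) : Prop :=
  f22 α β γ δ ≠ 0 ∧ f20 α β γ δ ≠ 0 ∧ f02 α β γ δ ≠ 0 ∧ f00 α β γ δ ≠ 0

def g22 (α β γ δ : ℝ) : ℝ := sin (semi α β γ δ - α - δ) * sin (semi α β γ δ - β - δ)
def g20 (α β γ δ : ℝ) : ℝ := sin (semi α β γ δ - α) * sin (semi α β γ δ - β)
def g02 (α β γ δ : ℝ) : ℝ := -(sin (semi α β γ δ - γ) * sin (semi α β γ δ - δ))
def g00 (α β γ δ : ℝ) : ℝ := sin (semi α β γ δ) * sin (semi α β γ δ - α - β)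

/-- The polynomial relating the half-angle tangents `x`, `z` of opposite folding angles. -/
def oppositePoly (α β γ δ : ℝ) (x z : ℂ) : ℂ :=
  g22 α β γ δ * x ^ 2 * z ^ 2 + g20 α β γ δ * x ^ 2 + g02 α β γ δ * z ^ 2 + g00 α β γ δ

/-- The number `M`. -/
def ratioM (α β γ δ : ℝ) : ℝ :=
  (sin α * sin β * sin γ * sin δ)
    / (sin (semi α β γ δ - α) * sin (semi α β γ δ - β)
        * sin (semi α β γ δ - γ) * sin (semi α β γ δ - δ))

/-- Square root of a real number with the convention `√a = i √(-a)` for `a < 0`. -/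
def csqrt (a : ℝ) : ℂ := if 0 ≤ a then ((√a : ℝ) : ℂ) else Complex.I * ((√(-a) : ℝ) : ℂ)

/-- The amplitude `p_x`. The amplitudes `p_y`, `p_z`, `p_w` are obtained from it by rotating
the arguments cyclically. -/
def ampX (α β γ δ : ℝ) : ℂ :=
  csqrt (sin α * sin β / (sin (semi α β γ δ - α) * sin (semi α β γ δ - β)) - 1)
def ampY (α β γ δ : ℝ) : ℂ := ampX β γ δ α
def ampZ (α β γ δ : ℝ) : ℂ := ampX γ δ α β
def ampW (α β γ δ : ℝ) : ℂ := ampX δ α β γ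

/-- The left-hand side of the opposite relation in normalized form. -/
def oppositeForm (α β γ δ : ℝ) (x z : ℂ) : ℂ :=
  ((ratioM α β γ δ : ℂ) - 1) * (x ^ 2 * z ^ 2 / (ampX α β γ δ ^ 2 * ampZ α β γ δ ^ 2))
    + x ^ 2 / ampX α β γ δ ^ 2 + z ^ 2 / ampZ α β γ δ ^ 2 - 1

/-- `sin α sin γ / (sin (σ-α) sin (σ-γ))`. -/
def adjQ (α β γ δ : ℝ) : ℝ :=
  sin α * sin γ / (sin (semi α β γ δ - α) * sin (semi α β γ δ - γ))

/-- Constant coefficient of the normalized adjacent relation. -/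
def adjC (α β γ δ : ℝ) : ℝ :=
  sin (semi α β γ δ - β) * sin (semi α β γ δ - δ)
    / (sin (semi α β γ δ - α) * sin (semi α β γ δ - γ) - sin β * sin δ)

/-- Minus one half of the mixed coefficient of the normalized adjacent relation. -/
def adjB (α β γ δ : ℝ) : ℂ :=
  ((sin α * sin γ : ℝ) : ℂ)
    / csqrt (sin (semi α β γ δ - α) * sin (semi α β γ δ - γ)
        * (sin (semi α β γ δ - α) * sin (semi α β γ δ - γ) - sin β * sin δ))

/-- The left-hand side of the adjacent relation in normalized form. -/
def adjacentForm (α β γ δ : ℝ) (x y : ℂ) : ℂ :=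
  ((adjQ α β γ δ : ℂ) - 1) * (x ^ 2 * y ^ 2 / (ampX α β γ δ ^ 2 * ampY α β γ δ ^ 2))
    + x ^ 2 / ampX α β γ δ ^ 2 + y ^ 2 / ampY α β γ δ ^ 2 + adjC α β γ δ
    - 2 * adjB α β γ δ * (x * y / (ampX α β γ δ * ampY α β γ δ))

/-- The sign by which the mixed term of `adjacentPoly` differs from that of `adjacentForm`. -/
def adjSign (α β γ δ : ℝ) : ℂ := if γ + δ < semi α β γ δ then 1 else -1

/-- The finite complex zeros of `Φ` are exactly the points `(a φ(t), b φ(t + s))`, where `t`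
runs over the complex numbers such that neither `t` nor `t + s` is a pole. -/
def IsParametrizedBy (k : ℝ) (φ : ℂ → ℂ) (Φ : ℂ → ℂ → ℂ) (a b s : ℂ) : Prop :=
  ∀ u v : ℂ, Φ u v = 0 ↔
    ∃ t : ℂ, ¬ IsPole k t ∧ ¬ IsPole k (t + s) ∧ u = a * φ t ∧ v = b * φ (t + s)

/-- The equations which identify the normalized adjacent relation with the relation between
`cn t` and `cn (t - θ)`. -/
def CnPhaseEqs (k α β γ δ : ℝ) (θ : ℂ) : Prop :=
  (k : ℂ) ^ 2 * sn k θ ^ 2 / dn k θ ^ 2 = (adjQ α β γ δ : ℂ) - 1 ∧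
  cn k θ / dn k θ ^ 2 = adjB α β γ δ ∧
  ((k : ℂ) ^ 2 - 1) * sn k θ ^ 2 / dn k θ ^ 2 = adjC α β γ δ

/-- The equations which identify the normalized adjacent relation with the relation between
`sn t` and `sn (t - θ)`. -/
def SnPhaseEqs (k α β γ δ : ℝ) (θ : ℂ) : Prop :=
  -((k : ℂ) ^ 2 * sn k θ ^ 2) = (adjQ α β γ δ : ℂ) - 1 ∧
  cn k θ * dn k θ = adjB α β γ δ ∧
  -(sn k θ ^ 2) = adjC α β γ δ

end SphericalLinkage

end

open SphericalLinkage

/-!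
The complex Jacobi functions are defined by their real and imaginary parts in terms of the real
functions of moduli `k` and `k'`. The real functions satisfy `am' = dn`, so the
Cauchy–Riemann equations turn the definitions into holomorphic functions off the poles with
`sn' = cn dn`, `cn' = -sn dn`, `dn' = -k² sn cn` (`hasDerivAt_sn`, `hasDerivAt_cn`,
`hasDerivAt_dn`). The poles form a countable closed set, hence their complement is connected and the
identity theorem applies.

With the sum of the two arguments fixed, numerator and denominator of the addition formulas have
vanishing Wronskian, so they are proportional near `0`, and everywhere by the identity theorem
(`sn_add_mul`, `cn_add_mul`). Eliminating the derivatives `cn t`, `dn t` gives biquadratic relations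
between `sn t` and `sn (t + s)`, and between `cn t` and `cn (t + s)` (`sn_biquadratic`,
`cn_biquadratic`). Conversely, `sn` takes every complex value: its range is open, and it is closed
because of the two periods (`exists_sn_eq`). Given the first coordinate `sn t`, the biquadratic
relation is quadratic in the second one and its roots are `sn (t + s)` and `sn (t - s)`, which a
reflection of `t` interchanges; hence the relation is parametrized by `(sn t, sn (t + s))`, and
similarly for `cn` (`isParametrizedBy_sn`, `isParametrizedBy_cn`). This needs the leading coefficient
of the quadratic to be nonzero, and then neither `t + s` nor `t - s` is a pole
(`addition_den_eq_zero`). Where it vanishes, the equation has no solution for `s = K`; for `s = -θ` with `θ` between `0` and `iK'` it becomes linear with a single root, and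
`t + θ`, `t - θ` are not both poles.

The linkage enters through the relations of `SineRelations` between the sines of the angles. They
identify the opposite relation with the case `s = K`, and show that the three phase equations of the
adjacent relation all amount to the prescribed value of `dn θ` (`cn_phase_iff`, `sn_phase_iff`),
which exceeds `1` and so is taken exactly once on the segment (`existsUnique_dn_eq`). The
hypotheses on `σ` and `α + γ` make the squares of the two amplitudes `p_x`, `p_y` have the same
sign, and then the mixed term of the polynomial agrees with that of the normalized form up to the
sign `adjSign` (`amp_mul_amp`).
-/

namespace SphericalLinkage

/-! ### The real Jacobi functions -/

lemma sq_lt_one_of_modulus {k : ℝ} (hk : k ∈ Ioo (0 : ℝ) 1) : k ^ 2 < 1 := by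
  nlinarith [hk.1, hk.2]

lemma one_sub_sq_mul_sin_sq_pos {k : ℝ} (hk : k ∈ Ioo (0 : ℝ) 1) (φ : ℝ) :
    0 < 1 - k ^ 2 * Real.sin φ ^ 2 := by
  nlinarith [sq_lt_one_of_modulus hk, Real.sin_sq_le_one φ, sq_nonneg (Real.sin φ), sq_nonneg k]

lemma complModulus_mem {k : ℝ} (hk : k ∈ Ioo (0 : ℝ) 1) : complModulus k ∈ Ioo (0 : ℝ) 1 := by
  have h := sq_lt_one_of_modulus hk
  refine ⟨Real.sqrt_pos.2 (by linarith), ?_⟩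
  rw [complModulus, Real.sqrt_lt' one_pos]
  nlinarith [hk.1]

lemma complModulus_sq {k : ℝ} (hk : k ∈ Ioo (0 : ℝ) 1) : complModulus k ^ 2 = 1 - k ^ 2 :=
  Real.sq_sqrt (by linarith [sq_lt_one_of_modulus hk])

lemma continuous_ellipticF_integrand {k : ℝ} (hk : k ∈ Ioo (0 : ℝ) 1) :
    Continuous fun ψ : ℝ => 1 / √(1 - k ^ 2 * Real.sin ψ ^ 2) :=
  continuous_const.div (by fun_prop)
    fun ψ => (Real.sqrt_pos.2 (one_sub_sq_mul_sin_sq_pos hk ψ)).ne'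

lemma hasDerivAt_ellipticF {k : ℝ} (hk : k ∈ Ioo (0 : ℝ) 1) (φ : ℝ) :
    HasDerivAt (ellipticF k) (1 / √(1 - k ^ 2 * Real.sin φ ^ 2)) φ := by
  have hc := continuous_ellipticF_integrand hk
  exact intervalIntegral.integral_hasDerivAt_right (hc.intervalIntegrable _ _)
    (hc.stronglyMeasurableAtFilter _ _) hc.continuousAt

lemma ellipticF_zero (k : ℝ) : ellipticF k 0 = 0 := by simp [ellipticF]

lemma ellipticF_neg (k φ : ℝ) : ellipticF k (-φ) = -ellipticF k φ := by
  have h := intervalIntegral.integral_comp_neg (a := 0) (b := φ)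
    (fun ψ : ℝ => 1 / √(1 - k ^ 2 * Real.sin ψ ^ 2))
  simp only [Real.sin_neg, neg_sq, neg_zero] at h
  rw [ellipticF, ellipticF, h, intervalIntegral.integral_symm]

lemma strictMono_ellipticF {k : ℝ} (hk : k ∈ Ioo (0 : ℝ) 1) : StrictMono (ellipticF k) :=
  strictMono_of_hasDerivAt_pos (hasDerivAt_ellipticF hk)
    fun φ => one_div_pos.2 (Real.sqrt_pos.2 (one_sub_sq_mul_sin_sq_pos hk φ))

/-- The integrand is at least one, so `ellipticF k` grows at least as fast as the identity. -/
lemma monotone_ellipticF_sub_id {k : ℝ} (hk : k ∈ Ioo (0 : ℝ) 1) :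
    Monotone fun φ => ellipticF k φ - φ := by
  refine monotone_of_hasDerivAt_nonneg
    (fun φ => (hasDerivAt_ellipticF hk φ).sub (hasDerivAt_id φ)) fun φ => ?_
  have h1 := Real.sqrt_pos.2 (one_sub_sq_mul_sin_sq_pos hk φ)
  have h2 : √(1 - k ^ 2 * Real.sin φ ^ 2) ≤ 1 := by
    refine Real.sqrt_le_iff.2 ⟨zero_le_one, ?_⟩
    nlinarith [mul_nonneg (sq_nonneg k) (sq_nonneg (Real.sin φ))]
  show 0 ≤ 1 / √(1 - k ^ 2 * Real.sin φ ^ 2) - 1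
  rw [sub_nonneg, le_div_iff₀ h1]
  linarith

lemma surjective_ellipticF {k : ℝ} (hk : k ∈ Ioo (0 : ℝ) 1) :
    Function.Surjective (ellipticF k) := by
  have hm := monotone_ellipticF_sub_id hk
  refine Continuous.surjective
    (continuous_iff_continuousAt.2 fun φ => (hasDerivAt_ellipticF hk φ).continuousAt) ?_ ?_
  · refine Filter.tendsto_atTop_mono' _ ?_ Filter.tendsto_id
    filter_upwards [Filter.eventually_ge_atTop 0] with φ hφ
    have := hm hφ
    simp only [ellipticF_zero, id] at this ⊢
    linarith
  · refine Filter.tendsto_atBot_mono' _ ?_ Filter.tendsto_id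
    filter_upwards [Filter.eventually_le_atBot 0] with φ hφ
    have := hm hφ
    simp only [ellipticF_zero, id] at this ⊢
    linarith

lemma am_ellipticF {k : ℝ} (hk : k ∈ Ioo (0 : ℝ) 1) (φ : ℝ) : am k (ellipticF k φ) = φ :=
  Function.leftInverse_invFun (strictMono_ellipticF hk).injective φ

lemma ellipticF_am {k : ℝ} (hk : k ∈ Ioo (0 : ℝ) 1) (x : ℝ) : ellipticF k (am k x) = x :=
  Function.rightInverse_invFun (surjective_ellipticF hk) x

lemma strictMono_am {k : ℝ} (hk : k ∈ Ioo (0 : ℝ) 1) : StrictMono (am k) := fun x y h => by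
  rw [← (strictMono_ellipticF hk).lt_iff_lt, ellipticF_am hk, ellipticF_am hk]
  exact h

lemma continuous_am {k : ℝ} (hk : k ∈ Ioo (0 : ℝ) 1) : Continuous (am k) :=
  (strictMono_am hk).monotone.continuous_of_surjective fun φ => ⟨_, am_ellipticF hk φ⟩

lemma hasDerivAt_am {k : ℝ} (hk : k ∈ Ioo (0 : ℝ) 1) (x : ℝ) :
    HasDerivAt (am k) (dnReal k x) x := by
  have hpos := Real.sqrt_pos.2 (one_sub_sq_mul_sin_sq_pos hk (am k x))
  have h := HasDerivAt.of_local_left_inverse (continuous_am hk).continuousAt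
    (hasDerivAt_ellipticF hk (am k x)) (one_div_pos.2 hpos).ne'
    (Filter.Eventually.of_forall fun y => ellipticF_am hk y)
  rwa [one_div, inv_inv] at h

lemma am_zero {k : ℝ} (hk : k ∈ Ioo (0 : ℝ) 1) : am k 0 = 0 := by
  simpa [ellipticF_zero] using am_ellipticF hk 0

lemma am_neg {k : ℝ} (hk : k ∈ Ioo (0 : ℝ) 1) (x : ℝ) : am k (-x) = -am k x := by
  rw [← (strictMono_ellipticF hk).injective.eq_iff, ellipticF_neg, ellipticF_am hk, ellipticF_am hk]

lemma am_quarterPeriod {k : ℝ} (hk : k ∈ Ioo (0 : ℝ) 1) : am k (quarterPeriod k) = π / 2 :=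
  am_ellipticF hk _

lemma quarterPeriod_pos {k : ℝ} (hk : k ∈ Ioo (0 : ℝ) 1) : 0 < quarterPeriod k := by
  rw [← ellipticF_zero k]
  exact strictMono_ellipticF hk (by positivity)

lemma ellipticF_add_pi {k : ℝ} (hk : k ∈ Ioo (0 : ℝ) 1) (φ : ℝ) :
    ellipticF k (φ + π) = ellipticF k φ + 2 * quarterPeriod k := by
  have hd : ∀ ψ : ℝ, HasDerivAt (fun ψ => ellipticF k (ψ + π) - ellipticF k ψ) 0 ψ := fun ψ => by
    have h := ((hasDerivAt_ellipticF hk (ψ + π)).comp_add_const ψ π).sub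
      (hasDerivAt_ellipticF hk ψ)
    rwa [Real.sin_add_pi, neg_sq, sub_self] at h
  have h := is_const_of_deriv_eq_zero (fun ψ => (hd ψ).differentiableAt)
    (fun ψ => (hd ψ).deriv) φ (-(π / 2))
  rw [show -(π / 2) + π = π / 2 by ring, ellipticF_neg] at h
  rw [quarterPeriod]
  linarith

lemma am_add_two_quarterPeriod {k : ℝ} (hk : k ∈ Ioo (0 : ℝ) 1) (x : ℝ) :
    am k (x + 2 * quarterPeriod k) = am k x + π := by
  rw [← (strictMono_ellipticF hk).injective.eq_iff, ellipticF_add_pi hk, ellipticF_am hk,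
    ellipticF_am hk]

lemma snReal_sq_add_cnReal_sq (k x : ℝ) : snReal k x ^ 2 + cnReal k x ^ 2 = 1 :=
  Real.sin_sq_add_cos_sq _

lemma dnReal_sq {k : ℝ} (hk : k ∈ Ioo (0 : ℝ) 1) (x : ℝ) :
    dnReal k x ^ 2 = 1 - k ^ 2 * snReal k x ^ 2 :=
  Real.sq_sqrt (one_sub_sq_mul_sin_sq_pos hk _).le

lemma dnReal_pos {k : ℝ} (hk : k ∈ Ioo (0 : ℝ) 1) (x : ℝ) : 0 < dnReal k x :=
  Real.sqrt_pos.2 (one_sub_sq_mul_sin_sq_pos hk _)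

lemma hasDerivAt_snReal {k : ℝ} (hk : k ∈ Ioo (0 : ℝ) 1) (x : ℝ) :
    HasDerivAt (snReal k) (cnReal k x * dnReal k x) x :=
  (hasDerivAt_am hk x).sin

lemma hasDerivAt_cnReal {k : ℝ} (hk : k ∈ Ioo (0 : ℝ) 1) (x : ℝ) :
    HasDerivAt (cnReal k) (-(snReal k x * dnReal k x)) x := by
  have h := (hasDerivAt_am hk x).cos
  rwa [neg_mul] at h

lemma hasDerivAt_dnReal {k : ℝ} (hk : k ∈ Ioo (0 : ℝ) 1) (x : ℝ) :
    HasDerivAt (dnReal k) (-(k ^ 2 * snReal k x * cnReal k x)) x := by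
  have h := ((((hasDerivAt_snReal hk x).pow 2).const_mul (k ^ 2)).const_sub 1).sqrt
    (one_sub_sq_mul_sin_sq_pos hk (am k x)).ne'
  have hd := (dnReal_pos hk x).ne'
  refine h.congr_deriv ?_
  change _ / (2 * dnReal k x) = _
  field_simp
  norm_num
  ring

lemma snReal_zero {k : ℝ} (hk : k ∈ Ioo (0 : ℝ) 1) : snReal k 0 = 0 := by
  simp [snReal, am_zero hk]

lemma cnReal_zero {k : ℝ} (hk : k ∈ Ioo (0 : ℝ) 1) : cnReal k 0 = 1 := by
  simp [cnReal, am_zero hk]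

lemma dnReal_zero {k : ℝ} (hk : k ∈ Ioo (0 : ℝ) 1) : dnReal k 0 = 1 := by
  simp [dnReal, am_zero hk]

lemma snReal_neg {k : ℝ} (hk : k ∈ Ioo (0 : ℝ) 1) (x : ℝ) : snReal k (-x) = -snReal k x := by
  simp [snReal, am_neg hk]

lemma cnReal_neg {k : ℝ} (hk : k ∈ Ioo (0 : ℝ) 1) (x : ℝ) : cnReal k (-x) = cnReal k x := by
  simp [cnReal, am_neg hk]

lemma dnReal_neg {k : ℝ} (hk : k ∈ Ioo (0 : ℝ) 1) (x : ℝ) : dnReal k (-x) = dnReal k x := by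
  simp [dnReal, am_neg hk]

lemma snReal_add_two_quarterPeriod {k : ℝ} (hk : k ∈ Ioo (0 : ℝ) 1) (x : ℝ) :
    snReal k (x + 2 * quarterPeriod k) = -snReal k x := by
  simp [snReal, am_add_two_quarterPeriod hk]

lemma cnReal_add_two_quarterPeriod {k : ℝ} (hk : k ∈ Ioo (0 : ℝ) 1) (x : ℝ) :
    cnReal k (x + 2 * quarterPeriod k) = -cnReal k x := by
  simp [cnReal, am_add_two_quarterPeriod hk]

lemma dnReal_add_two_quarterPeriod {k : ℝ} (hk : k ∈ Ioo (0 : ℝ) 1) (x : ℝ) :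
    dnReal k (x + 2 * quarterPeriod k) = dnReal k x := by
  simp [dnReal, am_add_two_quarterPeriod hk]

lemma snReal_quarterPeriod {k : ℝ} (hk : k ∈ Ioo (0 : ℝ) 1) : snReal k (quarterPeriod k) = 1 := by
  simp [snReal, am_quarterPeriod hk]

lemma cnReal_quarterPeriod {k : ℝ} (hk : k ∈ Ioo (0 : ℝ) 1) : cnReal k (quarterPeriod k) = 0 := by
  simp [cnReal, am_quarterPeriod hk]

lemma countable_snReal_eq_zero {k : ℝ} (hk : k ∈ Ioo (0 : ℝ) 1) :
    {x | snReal k x = 0}.Countable := by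
  refine (countable_range fun n : ℤ => ellipticF k (n * π)).mono fun x hx => ?_
  obtain ⟨n, hn⟩ := Real.sin_eq_zero_iff.1 hx
  exact ⟨n, by simp only [hn, ellipticF_am hk]⟩

lemma countable_cnReal_eq_zero {k : ℝ} (hk : k ∈ Ioo (0 : ℝ) 1) :
    {x | cnReal k x = 0}.Countable := by
  refine (countable_range fun n : ℤ => ellipticF k ((2 * n + 1) * π / 2)).mono fun x hx => ?_
  obtain ⟨n, hn⟩ := Real.cos_eq_zero_iff.1 hx
  exact ⟨n, by simp only [← hn, ellipticF_am hk]⟩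

/-- Distinct zeros of `cnReal k` are at least `2K` apart. -/
lemma cnReal_ne_zero_of_lt {k : ℝ} (hk : k ∈ Ioo (0 : ℝ) 1) {x y : ℝ} (hx : cnReal k x = 0)
    (hxy : x < y) (hyx : y < x + 2 * quarterPeriod k) : cnReal k y ≠ 0 := fun hy => by
  obtain ⟨m, hm⟩ := Real.cos_eq_zero_iff.1 hx
  obtain ⟨n, hn⟩ := Real.cos_eq_zero_iff.1 hy
  have h1 := strictMono_am hk hxy
  have h2 := strictMono_am hk hyx
  rw [am_add_two_quarterPeriod hk] at h2
  rw [hm, hn] at h1 h2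
  have h3 : (m : ℝ) < n := by nlinarith [Real.pi_pos]
  have h4 : (n : ℝ) < m + 1 := by nlinarith [Real.pi_pos]
  norm_cast at h3 h4
  omega

/-- On `(0, K)` the function `snReal k` takes each value in `(0, 1)` exactly once. -/
lemma existsUnique_snReal_eq {k : ℝ} (hk : k ∈ Ioo (0 : ℝ) 1) {r : ℝ} (hr : r ∈ Ioo (0 : ℝ) 1) :
    ∃! x, x ∈ Ioo 0 (quarterPeriod k) ∧ snReal k x = r := by
  have hmem : ∀ x, x ∈ Ioo 0 (quarterPeriod k) ↔ am k x ∈ Ioo 0 (π / 2) := fun x => by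
    have h := (strictMono_am hk).lt_iff_lt (a := 0) (b := x)
    rw [am_zero hk] at h
    rw [mem_Ioo, mem_Ioo, h, ← am_quarterPeriod hk, (strictMono_am hk).lt_iff_lt]
  have ha : Real.arcsin r ∈ Ioo 0 (π / 2) :=
    ⟨Real.arcsin_pos.2 hr.1, Real.arcsin_lt_pi_div_two.2 hr.2⟩
  refine ⟨ellipticF k (Real.arcsin r), ⟨?_, ?_⟩, ?_⟩
  · rw [hmem, am_ellipticF hk]
    exact ha
  · rw [snReal, am_ellipticF hk, Real.sin_arcsin (by linarith [hr.1]) hr.2.le]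
  · rintro x ⟨hx, rfl⟩
    rw [hmem] at hx
    rw [snReal, Real.arcsin_sin (by linarith [hx.1, Real.pi_pos]) hx.2.le, ellipticF_am hk]

lemma snReal_mem_Ioo {k : ℝ} (hk : k ∈ Ioo (0 : ℝ) 1) {x : ℝ}
    (hx : x ∈ Ioo 0 (quarterPeriod k)) : snReal k x ∈ Ioo (0 : ℝ) 1 := by
  have h0 : 0 < am k x := am_zero hk ▸ strictMono_am hk hx.1
  have h1 : am k x < π / 2 := am_quarterPeriod hk ▸ strictMono_am hk hx.2
  refine ⟨Real.sin_pos_of_pos_of_lt_pi h0 (by linarith), ?_⟩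
  rw [snReal, ← Real.sin_pi_div_two]
  exact Real.sin_lt_sin_of_lt_of_le_pi_div_two (by linarith) le_rfl h1

lemma cnReal_pos {k : ℝ} (hk : k ∈ Ioo (0 : ℝ) 1) {x : ℝ}
    (hx : x ∈ Ioo 0 (quarterPeriod k)) : 0 < cnReal k x := by
  have h0 : 0 < am k x := am_zero hk ▸ strictMono_am hk hx.1
  have h1 : am k x < π / 2 := am_quarterPeriod hk ▸ strictMono_am hk hx.2
  exact Real.cos_pos_of_mem_Ioo ⟨by linarith, h1⟩

/-! ### Complex differentiability of the Jacobi functions -/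

/-- `f` is real differentiable at `t` with partial derivatives `p` in the real and `q` in the
imaginary direction. -/
def HasPartials (f : ℂ → ℂ) (t p q : ℂ) : Prop :=
  HasFDerivAt f (Complex.reCLM.smulRight p + Complex.imCLM.smulRight q : ℂ →L[ℝ] ℂ) t

namespace HasPartials

lemma comp_re {a : ℝ → ℝ} {a' : ℝ} {t : ℂ} (h : HasDerivAt a a' t.re) :
    HasPartials (fun z => (a z.re : ℂ)) t a' 0 := by
  have h1 := (h.ofReal_comp.hasFDerivAt).comp t Complex.reCLM.hasFDerivAt
  refine h1.congr_fderiv ?_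
  ext z
  simp

lemma comp_im {a : ℝ → ℝ} {a' : ℝ} {t : ℂ} (h : HasDerivAt a a' t.im) :
    HasPartials (fun z => (a z.im : ℂ)) t 0 a' := by
  have h1 := (h.ofReal_comp.hasFDerivAt).comp t Complex.imCLM.hasFDerivAt
  refine h1.congr_fderiv ?_
  ext z
  simp

variable {f g : ℂ → ℂ} {t p q p' q' : ℂ}

lemma congr_partials (h : HasPartials f t p q) (hp : p = p') (hq : q = q') :
    HasPartials f t p' q' := hp ▸ hq ▸ h

lemma const (c : ℂ) : HasPartials (fun _ => c) t 0 0 := by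
  refine (hasFDerivAt_const c t).congr_fderiv ?_
  ext z
  simp

lemma add (hf : HasPartials f t p q) (hg : HasPartials g t p' q') :
    HasPartials (fun z => f z + g z) t (p + p') (q + q') := by
  refine (HasFDerivAt.add hf hg).congr_fderiv ?_
  ext z
  simp
  ring

lemma sub (hf : HasPartials f t p q) (hg : HasPartials g t p' q') :
    HasPartials (fun z => f z - g z) t (p - p') (q - q') := by
  refine (HasFDerivAt.sub hf hg).congr_fderiv ?_
  ext z
  simp
  ring

lemma mul (hf : HasPartials f t p q) (hg : HasPartials g t p' q') :
    HasPartials (fun z => f z * g z) t (p * g t + f t * p') (q * g t + f t * q') := by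
  refine (HasFDerivAt.mul hf hg).congr_fderiv ?_
  ext z
  simp
  ring

lemma pow_two (hf : HasPartials f t p q) :
    HasPartials (fun z => f z ^ 2) t (2 * f t * p) (2 * f t * q) := by
  simp only [sq]
  exact (hf.mul hf).congr_partials (by ring) (by ring)

lemma div (hf : HasPartials f t p q) (hg : HasPartials g t p' q') (h : g t ≠ 0) :
    HasPartials (fun z => f z / g z) t ((p * g t - f t * p') / g t ^ 2)
      ((q * g t - f t * q') / g t ^ 2) := by
  have h1 := HasFDerivAt.mul hf ((hasFDerivAt_inv (𝕜 := ℂ) h).restrictScalars ℝ |>.comp t hg)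
  refine (h1.congr_of_eventuallyEq (Filter.Eventually.of_forall fun z => ?_)).congr_fderiv ?_
  · simp [div_eq_mul_inv]
  · ext z
    simp
    field_simp
    ring

/-- The Cauchy–Riemann equation `q = i p`. -/
lemma hasDerivAt (hf : HasPartials f t p q) (h : q = Complex.I * p) : HasDerivAt f p t := by
  rw [hasDerivAt_iff_hasFDerivAt]
  have h1 := HasFDerivAt.complexOfReal_hasFDerivAt hf (by simp [h])
  refine h1.congr_fderiv ?_
  ext
  simp

end HasPartials

lemma ofReal_snReal_sq_add (k x : ℝ) : (snReal k x : ℂ) ^ 2 + (cnReal k x : ℂ) ^ 2 = 1 := by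
  exact_mod_cast snReal_sq_add_cnReal_sq k x

lemma ofReal_dnReal_sq {k : ℝ} (hk : k ∈ Ioo (0 : ℝ) 1) (x : ℝ) :
    (dnReal k x : ℂ) ^ 2 = 1 - (k : ℂ) ^ 2 * (snReal k x : ℂ) ^ 2 := by
  exact_mod_cast dnReal_sq hk x

lemma ofReal_complModulus_sq {k : ℝ} (hk : k ∈ Ioo (0 : ℝ) 1) :
    (complModulus k : ℂ) ^ 2 = 1 - (k : ℂ) ^ 2 := by
  exact_mod_cast complModulus_sq hk

section

variable {k : ℝ} (hk : k ∈ Ioo (0 : ℝ) 1) (t : ℂ)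
include hk

lemma hasPartials_jacobiDen :
    HasPartials (fun z => (jacobiDen k z : ℂ)) t
      (2 * k ^ 2 * snReal k t.re * cnReal k t.re * dnReal k t.re
        * snReal (complModulus k) t.im ^ 2)
      (-2 * snReal (complModulus k) t.im * cnReal (complModulus k) t.im
        * dnReal (complModulus k) t.im * dnReal k t.re ^ 2) := by
  have hk' := complModulus_mem hk
  have hs := HasPartials.comp_re (hasDerivAt_snReal hk t.re)
  have hs' := HasPartials.comp_im (hasDerivAt_snReal hk' t.im)
  have hc' := HasPartials.comp_im (hasDerivAt_cnReal hk' t.im)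
  have h := hc'.pow_two.add (((HasPartials.const ((k : ℂ) ^ 2)).mul hs.pow_two).mul hs'.pow_two)
  have hd := ofReal_dnReal_sq hk t.re
  simp only [jacobiDen]
  push_cast at h ⊢
  exact h.congr_partials (by ring) (by rw [hd]; ring)

/-- The Cauchy–Riemann equations for `sn` are polynomial identities modulo the relations between the
squares of the real Jacobi functions, and likewise for `cn` and `dn`. -/
theorem hasDerivAt_sn (ht : ¬ IsPole k t) : HasDerivAt (sn k) (cn k t * dn k t) t := by
  have hk' := complModulus_mem hk
  have hs := HasPartials.comp_re (hasDerivAt_snReal hk t.re)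
  have hc := HasPartials.comp_re (hasDerivAt_cnReal hk t.re)
  have hd := HasPartials.comp_re (hasDerivAt_dnReal hk t.re)
  have hs' := HasPartials.comp_im (hasDerivAt_snReal hk' t.im)
  have hc' := HasPartials.comp_im (hasDerivAt_cnReal hk' t.im)
  have hd' := HasPartials.comp_im (hasDerivAt_dnReal hk' t.im)
  have hD0 : (jacobiDen k t : ℂ) ≠ 0 := Complex.ofReal_ne_zero.2 ht
  have h := ((hs.mul hd').add ((HasPartials.const Complex.I).mul
    (((hc.mul hd).mul hs').mul hc'))).div (hasPartials_jacobiDen hk t) hD0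
  have e1 := ofReal_snReal_sq_add k t.re
  have e2 := ofReal_dnReal_sq hk t.re
  have e3 := ofReal_snReal_sq_add (complModulus k) t.im
  have e4 := ofReal_dnReal_sq hk' t.im
  have e5 := ofReal_complModulus_sq hk
  have e6 := Complex.I_sq
  have hden : (jacobiDen k t : ℂ) = cnReal (complModulus k) t.im ^ 2
    + k ^ 2 * snReal k t.re ^ 2 * snReal (complModulus k) t.im ^ 2 := by
    simp only [jacobiDen]; push_cast; ring
  have hf : sn k = fun z => ((snReal k z.re : ℂ) * dnReal (complModulus k) z.im
      + Complex.I * ((cnReal k z.re : ℂ) * dnReal k z.re * snReal (complModulus k) z.im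
        * cnReal (complModulus k) z.im)) / (jacobiDen k z : ℂ) := by
    funext z
    simp only [sn]
    push_cast
    rfl
  rw [hf]
  refine (h.congr_partials (p' := cn k t * dn k t) (q' := Complex.I * (cn k t * dn k t))
    ?_ ?_).hasDerivAt rfl
  · rw [cn, dn, div_mul_div_comm, ← sq]
    congr 1
    rw [hden]
    push_cast
    rw [e5] at e4
    generalize (snReal k t.re : ℂ) = S at *
    generalize (cnReal k t.re : ℂ) = C at *
    generalize (dnReal k t.re : ℂ) = D at *
    generalize (snReal (complModulus k) t.im : ℂ) = S' at *
    generalize (cnReal (complModulus k) t.im : ℂ) = C' at *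
    generalize (dnReal (complModulus k) t.im : ℂ) = D' at *
    generalize (k : ℂ) ^ 2 = m at *
    clear h hf hden hs hc hd hs' hc' hd'
    grind
  · rw [cn, dn, div_mul_div_comm, ← sq, ← mul_div_assoc]
    congr 1
    rw [hden]
    push_cast
    rw [e5] at e4 ⊢
    generalize (snReal k t.re : ℂ) = S at *
    generalize (cnReal k t.re : ℂ) = C at *
    generalize (dnReal k t.re : ℂ) = D at *
    generalize (snReal (complModulus k) t.im : ℂ) = S' at *
    generalize (cnReal (complModulus k) t.im : ℂ) = C' at *
    generalize (dnReal (complModulus k) t.im : ℂ) = D' at *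
    generalize (k : ℂ) ^ 2 = m at *
    clear h hf hden hs hc hd hs' hc' hd'
    grind

theorem hasDerivAt_cn (ht : ¬ IsPole k t) : HasDerivAt (cn k) (-(sn k t * dn k t)) t := by
  have hk' := complModulus_mem hk
  have hs := HasPartials.comp_re (hasDerivAt_snReal hk t.re)
  have hc := HasPartials.comp_re (hasDerivAt_cnReal hk t.re)
  have hd := HasPartials.comp_re (hasDerivAt_dnReal hk t.re)
  have hs' := HasPartials.comp_im (hasDerivAt_snReal hk' t.im)
  have hc' := HasPartials.comp_im (hasDerivAt_cnReal hk' t.im)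
  have hd' := HasPartials.comp_im (hasDerivAt_dnReal hk' t.im)
  have hD0 : (jacobiDen k t : ℂ) ≠ 0 := Complex.ofReal_ne_zero.2 ht
  have h := ((hc.mul hc').sub ((HasPartials.const Complex.I).mul
    (((hs.mul hd).mul hs').mul hd'))).div (hasPartials_jacobiDen hk t) hD0
  have e1 := ofReal_snReal_sq_add k t.re
  have e2 := ofReal_dnReal_sq hk t.re
  have e3 := ofReal_snReal_sq_add (complModulus k) t.im
  have e4 := ofReal_dnReal_sq hk' t.im
  have e5 := ofReal_complModulus_sq hk
  have e6 := Complex.I_sq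
  have hden : (jacobiDen k t : ℂ) = cnReal (complModulus k) t.im ^ 2
    + k ^ 2 * snReal k t.re ^ 2 * snReal (complModulus k) t.im ^ 2 := by
    simp only [jacobiDen]; push_cast; ring
  have hf : cn k = fun z => ((cnReal k z.re : ℂ) * cnReal (complModulus k) z.im
      - Complex.I * ((snReal k z.re : ℂ) * dnReal k z.re * snReal (complModulus k) z.im
        * dnReal (complModulus k) z.im)) / (jacobiDen k z : ℂ) := by
    funext z
    simp only [cn]
    push_cast
    rfl
  rw [hf]
  refine (h.congr_partials (p' := -(sn k t * dn k t)) (q' := Complex.I * -(sn k t * dn k t))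
    ?_ ?_).hasDerivAt rfl
  · rw [sn, dn, div_mul_div_comm, ← sq, ← neg_div]
    congr 1
    rw [hden]
    push_cast
    rw [e5] at e4
    generalize (snReal k t.re : ℂ) = S at *
    generalize (cnReal k t.re : ℂ) = C at *
    generalize (dnReal k t.re : ℂ) = D at *
    generalize (snReal (complModulus k) t.im : ℂ) = S' at *
    generalize (cnReal (complModulus k) t.im : ℂ) = C' at *
    generalize (dnReal (complModulus k) t.im : ℂ) = D' at *
    generalize (k : ℂ) ^ 2 = m at *
    clear h hf hden hs hc hd hs' hc' hd'
    grind
  · rw [sn, dn, div_mul_div_comm, ← sq, ← neg_div, ← mul_div_assoc]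
    congr 1
    rw [hden]
    push_cast
    rw [e5] at e4 ⊢
    generalize (snReal k t.re : ℂ) = S at *
    generalize (cnReal k t.re : ℂ) = C at *
    generalize (dnReal k t.re : ℂ) = D at *
    generalize (snReal (complModulus k) t.im : ℂ) = S' at *
    generalize (cnReal (complModulus k) t.im : ℂ) = C' at *
    generalize (dnReal (complModulus k) t.im : ℂ) = D' at *
    generalize (k : ℂ) ^ 2 = m at *
    clear h hf hden hs hc hd hs' hc' hd'
    grind

theorem hasDerivAt_dn (ht : ¬ IsPole k t) :
    HasDerivAt (dn k) (-(k ^ 2 * (sn k t * cn k t))) t := by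
  have hk' := complModulus_mem hk
  have hs := HasPartials.comp_re (hasDerivAt_snReal hk t.re)
  have hc := HasPartials.comp_re (hasDerivAt_cnReal hk t.re)
  have hd := HasPartials.comp_re (hasDerivAt_dnReal hk t.re)
  have hs' := HasPartials.comp_im (hasDerivAt_snReal hk' t.im)
  have hc' := HasPartials.comp_im (hasDerivAt_cnReal hk' t.im)
  have hd' := HasPartials.comp_im (hasDerivAt_dnReal hk' t.im)
  have hD0 : (jacobiDen k t : ℂ) ≠ 0 := Complex.ofReal_ne_zero.2 ht
  have h := (((hd.mul hc').mul hd').sub ((HasPartials.const Complex.I).mul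
    ((((HasPartials.const ((k : ℂ) ^ 2)).mul hs).mul hc).mul hs'))).div
      (hasPartials_jacobiDen hk t) hD0
  have e1 := ofReal_snReal_sq_add k t.re
  have e2 := ofReal_dnReal_sq hk t.re
  have e3 := ofReal_snReal_sq_add (complModulus k) t.im
  have e4 := ofReal_dnReal_sq hk' t.im
  have e5 := ofReal_complModulus_sq hk
  have e6 := Complex.I_sq
  have hden : (jacobiDen k t : ℂ) = cnReal (complModulus k) t.im ^ 2
    + k ^ 2 * snReal k t.re ^ 2 * snReal (complModulus k) t.im ^ 2 := by
    simp only [jacobiDen]; push_cast; ring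
  have hf : dn k = fun z => ((dnReal k z.re : ℂ) * cnReal (complModulus k) z.im
      * dnReal (complModulus k) z.im - Complex.I * ((k : ℂ) ^ 2 * snReal k z.re * cnReal k z.re
        * snReal (complModulus k) z.im)) / (jacobiDen k z : ℂ) := by
    funext z
    simp only [dn]
    push_cast
    rfl
  rw [hf]
  refine (h.congr_partials (p' := -(k ^ 2 * (sn k t * cn k t)))
    (q' := Complex.I * -(k ^ 2 * (sn k t * cn k t))) ?_ ?_).hasDerivAt rfl
  · rw [sn, cn, div_mul_div_comm, ← sq, ← mul_div_assoc, ← neg_div]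
    congr 1
    rw [hden]
    push_cast
    rw [e5] at e4
    generalize (snReal k t.re : ℂ) = S at *
    generalize (cnReal k t.re : ℂ) = C at *
    generalize (dnReal k t.re : ℂ) = D at *
    generalize (snReal (complModulus k) t.im : ℂ) = S' at *
    generalize (cnReal (complModulus k) t.im : ℂ) = C' at *
    generalize (dnReal (complModulus k) t.im : ℂ) = D' at *
    generalize (k : ℂ) ^ 2 = m at *
    clear h hf hden hs hc hd hs' hc' hd'
    grind
  · rw [sn, cn, div_mul_div_comm, ← sq, ← mul_div_assoc, ← neg_div, ← mul_div_assoc]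
    congr 1
    rw [hden]
    push_cast
    rw [e5] at e4 ⊢
    generalize (snReal k t.re : ℂ) = S at *
    generalize (cnReal k t.re : ℂ) = C at *
    generalize (dnReal k t.re : ℂ) = D at *
    generalize (snReal (complModulus k) t.im : ℂ) = S' at *
    generalize (cnReal (complModulus k) t.im : ℂ) = C' at *
    generalize (dnReal (complModulus k) t.im : ℂ) = D' at *
    generalize (k : ℂ) ^ 2 = m at *
    clear h hf hden hs hc hd hs' hc' hd'
    grind

end

/-! ### Algebraic relations, symmetries and poles -/

lemma sn_sq_add_cn_sq {k : ℝ} (hk : k ∈ Ioo (0 : ℝ) 1) {t : ℂ} (ht : ¬ IsPole k t) :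
    sn k t ^ 2 + cn k t ^ 2 = 1 := by
  have hD0 : (jacobiDen k t : ℂ) ≠ 0 := Complex.ofReal_ne_zero.2 ht
  have e1 := ofReal_snReal_sq_add k t.re
  have e2 := ofReal_dnReal_sq hk t.re
  have e3 := ofReal_snReal_sq_add (complModulus k) t.im
  have e4 := ofReal_dnReal_sq (complModulus_mem hk) t.im
  have e6 := Complex.I_sq
  rw [ofReal_complModulus_sq hk] at e4
  have hden : (jacobiDen k t : ℂ) = cnReal (complModulus k) t.im ^ 2
    + k ^ 2 * snReal k t.re ^ 2 * snReal (complModulus k) t.im ^ 2 := by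
    simp only [jacobiDen]; push_cast; ring
  rw [sn, cn, div_pow, div_pow, ← add_div, div_eq_one_iff_eq (pow_ne_zero 2 hD0), hden]
  push_cast
  clear hden hD0
  grind

lemma dn_sq {k : ℝ} (hk : k ∈ Ioo (0 : ℝ) 1) {t : ℂ} (ht : ¬ IsPole k t) :
    dn k t ^ 2 = 1 - k ^ 2 * sn k t ^ 2 := by
  have hD0 : (jacobiDen k t : ℂ) ≠ 0 := Complex.ofReal_ne_zero.2 ht
  have e1 := ofReal_snReal_sq_add k t.re
  have e2 := ofReal_dnReal_sq hk t.re
  have e3 := ofReal_snReal_sq_add (complModulus k) t.im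
  have e4 := ofReal_dnReal_sq (complModulus_mem hk) t.im
  have e6 := Complex.I_sq
  rw [ofReal_complModulus_sq hk] at e4
  have hden : (jacobiDen k t : ℂ) = cnReal (complModulus k) t.im ^ 2
    + k ^ 2 * snReal k t.re ^ 2 * snReal (complModulus k) t.im ^ 2 := by
    simp only [jacobiDen]; push_cast; ring
  rw [eq_sub_iff_add_eq, sn, dn, div_pow, div_pow, ← mul_div_assoc, ← add_div,
    div_eq_one_iff_eq (pow_ne_zero 2 hD0), hden]
  push_cast
  clear hden hD0
  grind

/-- A formula for `|sn t|²` as a quotient whose numerator, unlike that in the definition of `sn`,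
does not vanish at the poles. -/
lemma norm_sn_sq_mul_jacobiDen {k : ℝ} (hk : k ∈ Ioo (0 : ℝ) 1) {t : ℂ} (ht : ¬ IsPole k t) :
    ‖sn k t‖ ^ 2 * jacobiDen k t
      = snReal k t.re ^ 2 * cnReal (complModulus k) t.im ^ 2
        + snReal (complModulus k) t.im ^ 2 := by
  have hD0 : jacobiDen k t ≠ 0 := ht
  have e1 := snReal_sq_add_cnReal_sq k t.re
  have e2 := dnReal_sq hk t.re
  have e3 := snReal_sq_add_cnReal_sq (complModulus k) t.im
  have e4 := dnReal_sq (complModulus_mem hk) t.im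
  rw [complModulus_sq hk] at e4
  have hn : ‖sn k t‖ ^ 2 = ((snReal k t.re * dnReal (complModulus k) t.im) ^ 2
      + (cnReal k t.re * dnReal k t.re * snReal (complModulus k) t.im
        * cnReal (complModulus k) t.im) ^ 2) / jacobiDen k t ^ 2 := by
    rw [sn, norm_div, div_pow, Complex.norm_real, Real.norm_eq_abs, sq_abs, mul_comm Complex.I,
      Complex.sq_norm, Complex.normSq_add_mul_I]
  have hden : jacobiDen k t = cnReal (complModulus k) t.im ^ 2
    + k ^ 2 * snReal k t.re ^ 2 * snReal (complModulus k) t.im ^ 2 := rfl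
  rw [hn, div_mul_eq_mul_div, div_eq_iff (pow_ne_zero 2 hD0), hden]
  clear hn hD0 hden
  grind

lemma jacobiDen_neg {k : ℝ} (hk : k ∈ Ioo (0 : ℝ) 1) (t : ℂ) :
    jacobiDen k (-t) = jacobiDen k t := by
  simp [jacobiDen, snReal_neg hk, cnReal_neg (complModulus_mem hk),
    snReal_neg (complModulus_mem hk)]

lemma isPole_neg {k : ℝ} (hk : k ∈ Ioo (0 : ℝ) 1) {t : ℂ} : IsPole k (-t) ↔ IsPole k t := by
  rw [IsPole, jacobiDen_neg hk, IsPole]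

lemma isPole_sub_comm {k : ℝ} (hk : k ∈ Ioo (0 : ℝ) 1) {t w : ℂ} :
    IsPole k (t - w) ↔ IsPole k (w - t) := by
  rw [← isPole_neg hk, neg_sub]

lemma sn_neg {k : ℝ} (hk : k ∈ Ioo (0 : ℝ) 1) (t : ℂ) : sn k (-t) = -sn k t := by
  simp only [sn, jacobiDen_neg hk, Complex.neg_re, Complex.neg_im, snReal_neg hk, cnReal_neg hk,
    dnReal_neg hk, snReal_neg (complModulus_mem hk), cnReal_neg (complModulus_mem hk),
    dnReal_neg (complModulus_mem hk)]
  push_cast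
  ring

lemma cn_neg {k : ℝ} (hk : k ∈ Ioo (0 : ℝ) 1) (t : ℂ) : cn k (-t) = cn k t := by
  simp only [cn, jacobiDen_neg hk, Complex.neg_re, Complex.neg_im, snReal_neg hk, cnReal_neg hk,
    dnReal_neg hk, snReal_neg (complModulus_mem hk), cnReal_neg (complModulus_mem hk),
    dnReal_neg (complModulus_mem hk)]
  push_cast
  ring

lemma dn_neg {k : ℝ} (hk : k ∈ Ioo (0 : ℝ) 1) (t : ℂ) : dn k (-t) = dn k t := by
  simp only [dn, jacobiDen_neg hk, Complex.neg_re, Complex.neg_im, snReal_neg hk, cnReal_neg hk,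
    dnReal_neg hk, snReal_neg (complModulus_mem hk), cnReal_neg (complModulus_mem hk),
    dnReal_neg (complModulus_mem hk)]
  push_cast
  ring

lemma jacobiDen_add_two_quarterPeriod {k : ℝ} (hk : k ∈ Ioo (0 : ℝ) 1) (t : ℂ) :
    jacobiDen k (t + 2 * quarterPeriod k) = jacobiDen k t := by
  simp [jacobiDen, snReal_add_two_quarterPeriod hk]

lemma isPole_add_two_quarterPeriod {k : ℝ} (hk : k ∈ Ioo (0 : ℝ) 1) {t : ℂ} :
    IsPole k (t + 2 * quarterPeriod k) ↔ IsPole k t := by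
  rw [IsPole, jacobiDen_add_two_quarterPeriod hk, IsPole]

lemma sn_add_two_quarterPeriod {k : ℝ} (hk : k ∈ Ioo (0 : ℝ) 1) (t : ℂ) :
    sn k (t + 2 * quarterPeriod k) = -sn k t := by
  have hre : (t + 2 * quarterPeriod k).re = t.re + 2 * quarterPeriod k := by simp
  have him : (t + 2 * quarterPeriod k).im = t.im := by simp
  simp only [sn, jacobiDen_add_two_quarterPeriod hk, hre, him, snReal_add_two_quarterPeriod hk,
    cnReal_add_two_quarterPeriod hk, dnReal_add_two_quarterPeriod hk]
  push_cast
  ring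

lemma cn_add_two_quarterPeriod {k : ℝ} (hk : k ∈ Ioo (0 : ℝ) 1) (t : ℂ) :
    cn k (t + 2 * quarterPeriod k) = -cn k t := by
  have hre : (t + 2 * quarterPeriod k).re = t.re + 2 * quarterPeriod k := by simp
  have him : (t + 2 * quarterPeriod k).im = t.im := by simp
  simp only [cn, jacobiDen_add_two_quarterPeriod hk, hre, him, snReal_add_two_quarterPeriod hk,
    cnReal_add_two_quarterPeriod hk, dnReal_add_two_quarterPeriod hk]
  push_cast
  ring

/-- The reflection `t ↦ 2K - t` preserves `sn`. -/
lemma sn_two_quarterPeriod_sub {k : ℝ} (hk : k ∈ Ioo (0 : ℝ) 1) (t : ℂ) :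
    sn k (2 * quarterPeriod k - t) = sn k t := by
  rw [show 2 * (quarterPeriod k : ℂ) - t = -t + 2 * quarterPeriod k by ring,
    sn_add_two_quarterPeriod hk, sn_neg hk, neg_neg]

lemma isPole_two_quarterPeriod_sub {k : ℝ} (hk : k ∈ Ioo (0 : ℝ) 1) {t : ℂ} :
    IsPole k (2 * quarterPeriod k - t) ↔ IsPole k t := by
  rw [show 2 * (quarterPeriod k : ℂ) - t = -t + 2 * quarterPeriod k by ring,
    isPole_add_two_quarterPeriod hk, isPole_neg hk]

lemma not_isPole_ofReal {k : ℝ} (hk : k ∈ Ioo (0 : ℝ) 1) (x : ℝ) : ¬ IsPole k (x : ℂ) := by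
  simp [IsPole, jacobiDen, snReal_zero (complModulus_mem hk), cnReal_zero (complModulus_mem hk)]

lemma not_isPole_zero {k : ℝ} (hk : k ∈ Ioo (0 : ℝ) 1) : ¬ IsPole k 0 := by
  simpa using not_isPole_ofReal hk 0

lemma sn_ofReal {k : ℝ} (hk : k ∈ Ioo (0 : ℝ) 1) (x : ℝ) : sn k x = snReal k x := by
  simp [sn, jacobiDen, snReal_zero (complModulus_mem hk), cnReal_zero (complModulus_mem hk),
    dnReal_zero (complModulus_mem hk)]

lemma cn_ofReal {k : ℝ} (hk : k ∈ Ioo (0 : ℝ) 1) (x : ℝ) : cn k x = cnReal k x := by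
  simp [cn, jacobiDen, snReal_zero (complModulus_mem hk), cnReal_zero (complModulus_mem hk)]

lemma dn_ofReal {k : ℝ} (hk : k ∈ Ioo (0 : ℝ) 1) (x : ℝ) : dn k x = dnReal k x := by
  simp [dn, jacobiDen, snReal_zero (complModulus_mem hk), cnReal_zero (complModulus_mem hk),
    dnReal_zero (complModulus_mem hk)]

lemma sn_zero {k : ℝ} (hk : k ∈ Ioo (0 : ℝ) 1) : sn k 0 = 0 := by
  simpa [snReal_zero hk] using sn_ofReal hk 0

lemma cn_zero {k : ℝ} (hk : k ∈ Ioo (0 : ℝ) 1) : cn k 0 = 1 := by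
  simpa [cnReal_zero hk] using cn_ofReal hk 0

lemma dn_zero {k : ℝ} (hk : k ∈ Ioo (0 : ℝ) 1) : dn k 0 = 1 := by
  simpa [dnReal_zero hk] using dn_ofReal hk 0

lemma isPole_iff {k : ℝ} (hk : k ∈ Ioo (0 : ℝ) 1) {t : ℂ} :
    IsPole k t ↔ snReal k t.re = 0 ∧ cnReal (complModulus k) t.im = 0 := by
  have e3 := snReal_sq_add_cnReal_sq (complModulus k) t.im
  rw [IsPole, jacobiDen, add_eq_zero_iff_of_nonneg (by positivity) (by positivity)]
  constructor
  · rintro ⟨h1, h2⟩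
    have h1' : cnReal (complModulus k) t.im = 0 := by simpa using h1
    have h3 : snReal (complModulus k) t.im ^ 2 = 1 := by rw [← e3, h1']; ring
    rw [h3] at h2
    exact ⟨by simpa [hk.1.ne'] using h2, h1'⟩
  · rintro ⟨h1, h2⟩
    simp [h1, h2]

lemma snReal_sq_eq_one_of_isPole {k : ℝ} (hk : k ∈ Ioo (0 : ℝ) 1) {t : ℂ} (ht : IsPole k t) :
    snReal (complModulus k) t.im ^ 2 = 1 := by
  have e3 := snReal_sq_add_cnReal_sq (complModulus k) t.im
  rw [((isPole_iff hk).1 ht).2] at e3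
  simpa using e3

lemma countable_isPole {k : ℝ} (hk : k ∈ Ioo (0 : ℝ) 1) : {t | IsPole k t}.Countable := by
  have h := ((countable_snReal_eq_zero hk).prod
    (countable_cnReal_eq_zero (complModulus_mem hk))).preimage
      Complex.equivRealProd.injective
  refine h.mono fun t ht => ?_
  exact (isPole_iff hk).1 ht

lemma continuous_snReal {k : ℝ} (hk : k ∈ Ioo (0 : ℝ) 1) : Continuous (snReal k) :=
  Real.continuous_sin.comp (continuous_am hk)

lemma continuous_cnReal {k : ℝ} (hk : k ∈ Ioo (0 : ℝ) 1) : Continuous (cnReal k) :=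
  Real.continuous_cos.comp (continuous_am hk)

lemma continuous_dnReal {k : ℝ} (hk : k ∈ Ioo (0 : ℝ) 1) : Continuous (dnReal k) :=
  continuous_iff_continuousAt.2 fun x => (hasDerivAt_dnReal hk x).continuousAt

lemma continuous_jacobiDen {k : ℝ} (hk : k ∈ Ioo (0 : ℝ) 1) : Continuous (jacobiDen k) := by
  have h1 := (continuous_snReal hk).comp Complex.continuous_re
  have h2 := (continuous_snReal (complModulus_mem hk)).comp Complex.continuous_im
  have h3 := (continuous_cnReal (complModulus_mem hk)).comp Complex.continuous_im
  exact (h3.pow 2).add ((continuous_const.mul (h1.pow 2)).mul (h2.pow 2))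

lemma isOpen_not_isPole {k : ℝ} (hk : k ∈ Ioo (0 : ℝ) 1) : IsOpen {t | ¬ IsPole k t} :=
  isOpen_ne.preimage (continuous_jacobiDen hk)

/-! ### Addition theorems -/

section

open Filter Topology

lemma isPreconnected_not_isPole {k : ℝ} (hk : k ∈ Ioo (0 : ℝ) 1) (w : ℂ) :
    IsPreconnected {t | ¬ IsPole k t ∧ ¬ IsPole k (t + w)} := by
  have hc : ({t | IsPole k t} ∪ (fun t => t + w) ⁻¹' {t | IsPole k t}).Countable :=
    (countable_isPole hk).union ((countable_isPole hk).preimage (add_left_injective w))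
  convert! (hc.isConnected_compl_of_one_lt_rank (by simp)).isPreconnected using 1
  ext t
  simp

lemma isOpen_not_isPole_and {k : ℝ} (hk : k ∈ Ioo (0 : ℝ) 1) (w : ℂ) :
    IsOpen {t | ¬ IsPole k t ∧ ¬ IsPole k (t + w)} :=
  (isOpen_not_isPole hk).inter ((isOpen_not_isPole hk).preimage (continuous_add_const w))

/-- The identity theorem on the complement of the poles of `t` and `t + w`. -/
lemma eq_zero_of_eventually_eq_zero {k : ℝ} (hk : k ∈ Ioo (0 : ℝ) 1) {w : ℂ} (hw : ¬ IsPole k w)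
    {h : ℂ → ℂ}
    (hd : ∀ t, ¬ IsPole k t → ¬ IsPole k (t + w) → DifferentiableAt ℂ h t)
    (h0 : ∀ᶠ t in 𝓝 0, h t = 0) {t : ℂ} (ht : ¬ IsPole k t) (htw : ¬ IsPole k (t + w)) :
    h t = 0 := by
  have ha : AnalyticOnNhd ℂ h {t | ¬ IsPole k t ∧ ¬ IsPole k (t + w)} :=
    DifferentiableOn.analyticOnNhd (fun z hz => (hd z hz.1 hz.2).differentiableWithinAt)
      (isOpen_not_isPole_and hk w)
  exact ha.eqOn_zero_of_preconnected_of_eventuallyEq_zero (isPreconnected_not_isPole hk w)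
    (z₀ := 0) ⟨not_isPole_zero hk, by rwa [zero_add]⟩ h0 ⟨ht, htw⟩

/-- If `G` and `N` have vanishing Wronskian, then `G` is a constant multiple of `N`: the quotient
is constant near `0`, and the identity theorem does the rest. -/
lemma eq_mul_of_wronskian_eq_zero {k : ℝ} (hk : k ∈ Ioo (0 : ℝ) 1) {w : ℂ} (hw : ¬ IsPole k w)
    {G N G' N' : ℂ → ℂ}
    (hG : ∀ t, ¬ IsPole k t → ¬ IsPole k (t + w) → HasDerivAt G (G' t) t)
    (hN : ∀ t, ¬ IsPole k t → ¬ IsPole k (t + w) → HasDerivAt N (N' t) t)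
    (hW : ∀ t, ¬ IsPole k t → ¬ IsPole k (t + w) → G' t * N t = G t * N' t)
    (h0 : N 0 = 1) {t : ℂ} (ht : ¬ IsPole k t) (htw : ¬ IsPole k (t + w)) :
    G t = G 0 * N t := by
  have hp0 : ¬ IsPole k 0 := not_isPole_zero hk
  have hp1 : ¬ IsPole k (0 + w) := by rwa [zero_add]
  have hev : ∀ᶠ z in 𝓝 (0 : ℂ), (¬ IsPole k z ∧ ¬ IsPole k (z + w)) ∧ N z ≠ 0 :=
    (Filter.Eventually.and ((isOpen_not_isPole_and hk w).mem_nhds ⟨hp0, hp1⟩)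
      ((hN 0 hp0 hp1).continuousAt.eventually_ne (by simp [h0])))
  obtain ⟨r, hr, hball⟩ := Metric.eventually_nhds_iff_ball.1 hev
  have hder : ∀ z ∈ Metric.ball (0 : ℂ) r, HasDerivAt (fun z => G z / N z) 0 z := fun z hz => by
    obtain ⟨⟨h1, h2⟩, h3⟩ := hball z hz
    have h := (hG z h1 h2).div (hN z h1 h2) h3
    rwa [hW z h1 h2, sub_self, zero_div] at h
  rw [← sub_eq_zero]
  refine eq_zero_of_eventually_eq_zero hk hw (h := fun z => G z - G 0 * N z)
    (fun z h1 h2 => ((hG z h1 h2).sub ((hN z h1 h2).const_mul _)).differentiableAt) ?_ ht htw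
  filter_upwards [Metric.ball_mem_nhds (0 : ℂ) hr] with z hz
  have hconst := Metric.isOpen_ball.is_const_of_deriv_eq_zero
    (convex_ball (0 : ℂ) r).isPreconnected
    (fun z hz => (hder z hz).differentiableAt.differentiableWithinAt)
    (fun z hz => (hder z hz).deriv) hz (Metric.mem_ball_self hr)
  simp only [h0, div_one] at hconst
  rw [div_eq_iff (hball z hz).2] at hconst
  rw [hconst, sub_self]

/-- The addition theorem for `sn`, by Euler's method: with the sum of the two arguments held
fixed, numerator and denominator have vanishing Wronskian. -/
theorem sn_add_mul {k : ℝ} (hk : k ∈ Ioo (0 : ℝ) 1) {t u : ℂ} (ht : ¬ IsPole k t)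
    (hu : ¬ IsPole k u) (htu : ¬ IsPole k (t + u)) :
    sn k (t + u) * (1 - k ^ 2 * sn k t ^ 2 * sn k u ^ 2)
      = sn k t * cn k u * dn k u + sn k u * cn k t * dn k t := by
  obtain ⟨w, rfl⟩ : ∃ w, u = w - t := ⟨t + u, by ring⟩
  rw [add_sub_cancel] at htu ⊢
  have hiff : ∀ z, IsPole k (z + -w) ↔ IsPole k (w - z) := fun z => by
    rw [← sub_eq_add_neg, isPole_sub_comm hk]
  have key := eq_mul_of_wronskian_eq_zero hk (w := -w) (by rwa [isPole_neg hk])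
    (G := fun z => sn k z * (cn k (w - z) * dn k (w - z)) + sn k (w - z) * (cn k z * dn k z))
    (N := fun z => 1 - k ^ 2 * (sn k z ^ 2 * sn k (w - z) ^ 2))
    (fun z h1 h2 => by
      rw [hiff] at h2
      exact ((hasDerivAt_sn hk z h1).mul (((hasDerivAt_cn hk _ h2).comp_const_sub w z).mul
        ((hasDerivAt_dn hk _ h2).comp_const_sub w z))).add
        (((hasDerivAt_sn hk _ h2).comp_const_sub w z).mul
          ((hasDerivAt_cn hk z h1).mul (hasDerivAt_dn hk z h1))))
    (fun z h1 h2 => by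
      rw [hiff] at h2
      exact ((((hasDerivAt_sn hk z h1).pow 2).mul
        (((hasDerivAt_sn hk _ h2).comp_const_sub w z).pow 2)).const_mul ((k : ℂ) ^ 2)).const_sub 1)
    (fun z h1 h2 => by
      rw [hiff] at h2
      have e1 := sn_sq_add_cn_sq hk h1
      have e2 := sn_sq_add_cn_sq hk h2
      have e3 := dn_sq hk h1
      have e4 := dn_sq hk h2
      simp only [Pi.mul_apply, Pi.pow_apply]
      grind)
    (by simp [sn_zero hk]) ht (by rwa [hiff])
  simp only [sub_zero, sn_zero hk, cn_zero hk, dn_zero hk] at key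
  linear_combination -key

/-- The addition theorem for `cn`. -/
theorem cn_add_mul {k : ℝ} (hk : k ∈ Ioo (0 : ℝ) 1) {t u : ℂ} (ht : ¬ IsPole k t)
    (hu : ¬ IsPole k u) (htu : ¬ IsPole k (t + u)) :
    cn k (t + u) * (1 - k ^ 2 * sn k t ^ 2 * sn k u ^ 2)
      = cn k t * cn k u - sn k t * dn k t * sn k u * dn k u := by
  obtain ⟨w, rfl⟩ : ∃ w, u = w - t := ⟨t + u, by ring⟩
  rw [add_sub_cancel] at htu ⊢
  have hiff : ∀ z, IsPole k (z + -w) ↔ IsPole k (w - z) := fun z => by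
    rw [← sub_eq_add_neg, isPole_sub_comm hk]
  have key := eq_mul_of_wronskian_eq_zero hk (w := -w) (by rwa [isPole_neg hk])
    (G := fun z => cn k z * cn k (w - z) - sn k z * dn k z * (sn k (w - z) * dn k (w - z)))
    (N := fun z => 1 - k ^ 2 * (sn k z ^ 2 * sn k (w - z) ^ 2))
    (fun z h1 h2 => by
      rw [hiff] at h2
      exact ((hasDerivAt_cn hk z h1).mul ((hasDerivAt_cn hk _ h2).comp_const_sub w z)).sub
        (((hasDerivAt_sn hk z h1).mul (hasDerivAt_dn hk z h1)).mul
          (((hasDerivAt_sn hk _ h2).comp_const_sub w z).mul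
            ((hasDerivAt_dn hk _ h2).comp_const_sub w z))))
    (fun z h1 h2 => by
      rw [hiff] at h2
      exact ((((hasDerivAt_sn hk z h1).pow 2).mul
        (((hasDerivAt_sn hk _ h2).comp_const_sub w z).pow 2)).const_mul ((k : ℂ) ^ 2)).const_sub 1)
    (fun z h1 h2 => by
      rw [hiff] at h2
      have e1 := sn_sq_add_cn_sq hk h1
      have e2 := sn_sq_add_cn_sq hk h2
      have e3 := dn_sq hk h1
      have e4 := dn_sq hk h2
      simp only [Pi.mul_apply, Pi.pow_apply]
      grind)
    (by simp [sn_zero hk]) ht (by rwa [hiff])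
  simp only [sub_zero, sn_zero hk, cn_zero hk, dn_zero hk] at key
  linear_combination -key

/-- The denominator of the addition theorems vanishes when the sum of the arguments is a pole: the
numerator stays bounded, while `sn` tends to infinity at a pole. -/
lemma addition_den_eq_zero {k : ℝ} (hk : k ∈ Ioo (0 : ℝ) 1) {t u : ℂ} (ht : ¬ IsPole k t)
    (hu : ¬ IsPole k u) (htu : IsPole k (t + u)) :
    1 - (k : ℂ) ^ 2 * sn k t ^ 2 * sn k u ^ 2 = 0 := by
  have hk' := complModulus_mem hk
  have hs := (hasDerivAt_sn hk t ht).continuousAt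
  have hc := (hasDerivAt_cn hk t ht).continuousAt
  have hd := (hasDerivAt_dn hk t ht).continuousAt
  have hshift : ContinuousAt (fun z : ℂ => z + u) t := by fun_prop
  have hre : ContinuousAt (fun z => snReal k (z + u).re) t :=
    ((continuous_snReal hk).comp Complex.continuous_re).continuousAt.comp hshift
  have hims : ContinuousAt (fun z => snReal (complModulus k) (z + u).im) t :=
    ((continuous_snReal hk').comp Complex.continuous_im).continuousAt.comp hshift
  have himc : ContinuousAt (fun z => cnReal (complModulus k) (z + u).im) t :=
    ((continuous_cnReal hk').comp Complex.continuous_im).continuousAt.comp hshift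
  have hj : ContinuousAt (fun z => jacobiDen k (z + u)) t :=
    (continuous_jacobiDen hk).continuousAt.comp hshift
  -- Both sides of the next identity are continuous at `t`, the left side vanishes there.
  have h1 : ContinuousAt (fun z => ‖sn k z * cn k u * dn k u + sn k u * cn k z * dn k z‖ ^ 2
      * jacobiDen k (z + u)) t := by fun_prop
  have h2 : ContinuousAt (fun z => ‖1 - (k : ℂ) ^ 2 * sn k z ^ 2 * sn k u ^ 2‖ ^ 2
      * (snReal k (z + u).re ^ 2 * cnReal (complModulus k) (z + u).im ^ 2
        + snReal (complModulus k) (z + u).im ^ 2)) t := by fun_prop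
  have hdense : Dense {z | ¬ IsPole k z ∧ ¬ IsPole k (z + u)} := by
    have hcount : ({z | IsPole k z} ∪ (fun z => z + u) ⁻¹' {z | IsPole k z}).Countable :=
      (countable_isPole hk).union ((countable_isPole hk).preimage (add_left_injective u))
    convert! hcount.dense_compl ℝ using 1
    ext z
    simp
  have hfreq := mem_closure_iff_frequently.1 (hdense t)
  have heq := tendsto_nhds_unique_of_frequently_eq h1 h2 (hfreq.mono fun z hz => by
    rw [← sn_add_mul hk hz.1 hu hz.2, ← norm_sn_sq_mul_jacobiDen hk hz.2, norm_mul]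
    ring)
  beta_reduce at heq
  rw [show jacobiDen k (t + u) = 0 from htu, snReal_sq_eq_one_of_isPole hk htu,
    ((isPole_iff hk).1 htu).1] at heq
  simpa using heq.symm

/-- The biquadratic relation between `sn t` and `sn (t + s)`. -/
theorem sn_biquadratic {k : ℝ} (hk : k ∈ Ioo (0 : ℝ) 1) {t s : ℂ} (ht : ¬ IsPole k t)
    (hs : ¬ IsPole k s) (hts : ¬ IsPole k (t + s)) :
    (1 - k ^ 2 * sn k t ^ 2 * sn k s ^ 2) * sn k (t + s) ^ 2
      - 2 * cn k s * dn k s * sn k t * sn k (t + s) + sn k t ^ 2 - sn k s ^ 2 = 0 := by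
  -- The addition theorem yields the claim where its denominator does not vanish.
  refine eq_zero_of_eventually_eq_zero hk hs
    (h := fun t => (1 - k ^ 2 * sn k t ^ 2 * sn k s ^ 2) * sn k (t + s) ^ 2
      - 2 * cn k s * dn k s * sn k t * sn k (t + s) + sn k t ^ 2 - sn k s ^ 2)
    (fun z h1 h2 => ?_) ?_ ht hts
  · have d1 := (hasDerivAt_sn hk z h1).differentiableAt
    have d2 := ((hasDerivAt_sn hk _ h2).comp_add_const z s).differentiableAt
    fun_prop
  · have hcont : ContinuousAt (fun z => 1 - (k : ℂ) ^ 2 * sn k z ^ 2 * sn k s ^ 2) 0 := by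
      have := (hasDerivAt_sn hk 0 (not_isPole_zero hk)).continuousAt
      fun_prop
    filter_upwards [hcont.eventually_ne (y := (0 : ℂ)) (by simp [sn_zero hk]),
      (isOpen_not_isPole_and hk s).mem_nhds (x := 0) ⟨not_isPole_zero hk, by rwa [zero_add]⟩]
      with z hz hp
    have e0 := sn_add_mul hk hp.1 hs hp.2
    have e1 := sn_sq_add_cn_sq hk hp.1
    have e2 := sn_sq_add_cn_sq hk hs
    have e3 := dn_sq hk hp.1
    have e4 := dn_sq hk hs
    refine (mul_eq_zero.1
      (?_ : (1 - (k : ℂ) ^ 2 * sn k z ^ 2 * sn k s ^ 2) * _ = 0)).resolve_left hz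
    linear_combination (sn k (z + s) * (1 - (k : ℂ) ^ 2 * sn k z ^ 2 * sn k s ^ 2)
      + (sn k z * cn k s * dn k s + sn k s * cn k z * dn k z) - 2 * cn k s * dn k s * sn k z) * e0
      + sn k s ^ 2 * dn k z ^ 2 * e1 + sn k s ^ 2 * (1 - sn k z ^ 2) * e3
      - sn k z ^ 2 * dn k s ^ 2 * e2 - sn k z ^ 2 * (1 - sn k s ^ 2) * e4

/-- The biquadratic relation between `cn t` and `cn (t + s)`. -/
theorem cn_biquadratic {k : ℝ} (hk : k ∈ Ioo (0 : ℝ) 1) {t s : ℂ} (ht : ¬ IsPole k t)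
    (hs : ¬ IsPole k s) (hts : ¬ IsPole k (t + s)) :
    (1 - k ^ 2 * sn k t ^ 2 * sn k s ^ 2) * cn k (t + s) ^ 2
      - 2 * cn k s * cn k t * cn k (t + s) + dn k s ^ 2 * cn k t ^ 2
      + (k ^ 2 - 1) * sn k s ^ 2 = 0 := by
  refine eq_zero_of_eventually_eq_zero hk hs
    (h := fun t => (1 - k ^ 2 * sn k t ^ 2 * sn k s ^ 2) * cn k (t + s) ^ 2
      - 2 * cn k s * cn k t * cn k (t + s) + dn k s ^ 2 * cn k t ^ 2
      + (k ^ 2 - 1) * sn k s ^ 2)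
    (fun z h1 h2 => ?_) ?_ ht hts
  · have d1 := (hasDerivAt_sn hk z h1).differentiableAt
    have d2 := ((hasDerivAt_cn hk _ h2).comp_add_const z s).differentiableAt
    have d3 := (hasDerivAt_cn hk z h1).differentiableAt
    fun_prop
  · have hcont : ContinuousAt (fun z => 1 - (k : ℂ) ^ 2 * sn k z ^ 2 * sn k s ^ 2) 0 := by
      have := (hasDerivAt_sn hk 0 (not_isPole_zero hk)).continuousAt
      fun_prop
    filter_upwards [hcont.eventually_ne (y := (0 : ℂ)) (by simp [sn_zero hk]),
      (isOpen_not_isPole_and hk s).mem_nhds (x := 0) ⟨not_isPole_zero hk, by rwa [zero_add]⟩]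
      with z hz hp
    have e0 := cn_add_mul hk hp.1 hs hp.2
    have e1 := sn_sq_add_cn_sq hk hp.1
    have e2 := sn_sq_add_cn_sq hk hs
    have e3 := dn_sq hk hp.1
    have e4 := dn_sq hk hs
    refine (mul_eq_zero.1
      (?_ : (1 - (k : ℂ) ^ 2 * sn k z ^ 2 * sn k s ^ 2) * _ = 0)).resolve_left hz
    linear_combination (cn k (z + s) * (1 - (k : ℂ) ^ 2 * sn k z ^ 2 * sn k s ^ 2)
      + (cn k z * cn k s - sn k z * dn k z * sn k s * dn k s) - 2 * cn k s * cn k z) * e0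
      + sn k z ^ 2 * sn k s ^ 2 * dn k s ^ 2 * e3
      + (sn k z ^ 2 * (1 - k ^ 2 * sn k z ^ 2) * sn k s ^ 2
        + (1 - (k : ℂ) ^ 2 * sn k z ^ 2 * sn k s ^ 2) * cn k z ^ 2) * e4
      - cn k z ^ 2 * e2
      + ((1 - (k : ℂ) ^ 2 * sn k z ^ 2 * sn k s ^ 2) * (1 - k ^ 2 * sn k s ^ 2) - (1 - sn k s ^ 2)) * e1

end

/-! ### Surjectivity of `sn` and `cn` -/

section

variable {k : ℝ} (hk : k ∈ Ioo (0 : ℝ) 1)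
include hk

lemma periodic_sn_re : Function.Periodic (sn k) (4 * quarterPeriod k) := fun t => by
  rw [show t + 4 * (quarterPeriod k : ℂ) = t + 2 * quarterPeriod k + 2 * quarterPeriod k by ring,
    sn_add_two_quarterPeriod hk, sn_add_two_quarterPeriod hk, neg_neg]

lemma periodic_jacobiDen_re : Function.Periodic (jacobiDen k) (4 * quarterPeriod k) := fun t => by
  rw [show t + 4 * (quarterPeriod k : ℂ) = t + 2 * quarterPeriod k + 2 * quarterPeriod k by ring,
    jacobiDen_add_two_quarterPeriod hk, jacobiDen_add_two_quarterPeriod hk]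

lemma periodic_jacobiDen_im :
    Function.Periodic (jacobiDen k) (2 * quarterPeriod (complModulus k) * Complex.I) := fun t => by
  have hk' := complModulus_mem hk
  simp [jacobiDen, snReal_add_two_quarterPeriod hk', cnReal_add_two_quarterPeriod hk']

lemma periodic_sn_im :
    Function.Periodic (sn k) (2 * quarterPeriod (complModulus k) * Complex.I) := fun t => by
  have hk' := complModulus_mem hk
  rw [sn, sn, periodic_jacobiDen_im hk t]
  simp [snReal_add_two_quarterPeriod hk', cnReal_add_two_quarterPeriod hk',
    dnReal_add_two_quarterPeriod hk']

/-- Every value of `sn` is taken in a period rectangle. -/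
lemma exists_mem_rectangle_sn_eq {t : ℂ} (ht : ¬ IsPole k t) :
    ∃ z ∈ Icc 0 (4 * quarterPeriod k) ×ℂ Icc 0 (2 * quarterPeriod (complModulus k)),
      ¬ IsPole k z ∧ sn k z = sn k t := by
  have hK := quarterPeriod_pos hk
  have hK' := quarterPeriod_pos (complModulus_mem hk)
  obtain ⟨m, hm, -⟩ := existsUnique_sub_zsmul_mem_Ico (a := 4 * quarterPeriod k) (by positivity)
    t.re 0
  obtain ⟨n, hn, -⟩ := existsUnique_sub_zsmul_mem_Ico (a := 2 * quarterPeriod (complModulus k))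
    (by positivity) t.im 0
  refine ⟨t - m • (4 * (quarterPeriod k : ℂ))
    - n • (2 * (quarterPeriod (complModulus k) : ℂ) * Complex.I), ?_, ?_, ?_⟩
  · rw [Complex.mem_reProdIm]
    constructor
    · convert! Ico_subset_Icc_self hm using 1 <;> simp
    · convert! Ico_subset_Icc_self hn using 1 <;> simp
  · rwa [IsPole, (periodic_jacobiDen_im hk).sub_zsmul_eq, (periodic_jacobiDen_re hk).sub_zsmul_eq]
  · rw [(periodic_sn_im hk).sub_zsmul_eq, (periodic_sn_re hk).sub_zsmul_eq]

lemma isClosed_range_sn : IsClosed (sn k '' {t | ¬ IsPole k t}) := by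
  have hk' := complModulus_mem hk
  have hcomp : IsCompact
      (Icc 0 (4 * quarterPeriod k) ×ℂ Icc 0 (2 * quarterPeriod (complModulus k))) :=
    isCompact_Icc.reProdIm isCompact_Icc
  have := isCompact_iff_compactSpace.1 hcomp
  set R := Icc 0 (4 * quarterPeriod k) ×ℂ Icc 0 (2 * quarterPeriod (complModulus k))
  -- The second equation keeps the limit points away from the poles.
  let T : Set (R × ℂ) := {p |
    p.2 * jacobiDen k p.1 = ((snReal k (p.1 : ℂ).re * dnReal (complModulus k) (p.1 : ℂ).im : ℝ)
      + Complex.I * (cnReal k (p.1 : ℂ).re * dnReal k (p.1 : ℂ).re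
        * snReal (complModulus k) (p.1 : ℂ).im * cnReal (complModulus k) (p.1 : ℂ).im : ℝ)) ∧
    ‖p.2‖ ^ 2 * jacobiDen k p.1
      = snReal k (p.1 : ℂ).re ^ 2 * cnReal (complModulus k) (p.1 : ℂ).im ^ 2
      + snReal (complModulus k) (p.1 : ℂ).im ^ 2}
  have hT : IsClosed T := by
    have c1 := continuous_snReal hk
    have c2 := continuous_cnReal hk
    have c3 := continuous_dnReal hk
    have c4 := continuous_snReal hk'
    have c5 := continuous_cnReal hk'
    have c6 := continuous_dnReal hk'
    have c7 := continuous_jacobiDen hk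
    refine (isClosed_eq ?_ ?_).inter (isClosed_eq ?_ ?_) <;> fun_prop
  have hTR : Prod.snd '' T = sn k '' {t | ¬ IsPole k t} := by
    ext w
    constructor
    · rintro ⟨⟨⟨t, htR⟩, w⟩, ⟨h1, h2⟩, rfl⟩
      have ht : ¬ IsPole k t := fun hp => by
        simp only at h2
        rw [show jacobiDen k t = 0 from hp, snReal_sq_eq_one_of_isPole hk hp,
          ((isPole_iff hk).1 hp).1] at h2
        norm_num at h2
      refine ⟨t, ht, ?_⟩
      rw [sn, ← h1, mul_div_cancel_right₀ _ (Complex.ofReal_ne_zero.2 ht)]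
    · rintro ⟨t, ht, rfl⟩
      obtain ⟨z, hzR, hz, hzt⟩ := exists_mem_rectangle_sn_eq hk ht
      refine ⟨(⟨z, hzR⟩, sn k z), ⟨?_, norm_sn_sq_mul_jacobiDen hk hz⟩, hzt⟩
      rw [sn, div_mul_cancel₀ _ (Complex.ofReal_ne_zero.2 hz)]
  rw [← hTR]
  exact isClosedMap_snd_of_compactSpace _ hT

lemma isOpen_range_sn : IsOpen (sn k '' {t | ¬ IsPole k t}) := by
  have hopen := isOpen_not_isPole hk
  have ha : AnalyticOnNhd ℂ (sn k) {t | ¬ IsPole k t} :=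
    DifferentiableOn.analyticOnNhd
      (fun z hz => (hasDerivAt_sn hk z hz).differentiableAt.differentiableWithinAt) hopen
  have hpre : IsPreconnected {t | ¬ IsPole k t} := by
    simpa using isPreconnected_not_isPole hk 0
  rcases ha.is_constant_or_isOpen hpre with ⟨w, hw⟩ | h
  · have h0 := hw 0 (not_isPole_zero hk)
    have h1 := hw (quarterPeriod k) (not_isPole_ofReal hk _)
    rw [sn_zero hk] at h0
    rw [sn_ofReal hk, snReal_quarterPeriod hk, ← h0] at h1
    norm_num at h1
  · exact h _ Subset.rfl hopen

/-- The range of `sn` is open by the open mapping theorem and closed by periodicity. -/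
theorem exists_sn_eq (w : ℂ) : ∃ t, ¬ IsPole k t ∧ sn k t = w := by
  have h := IsClopen.eq_univ ⟨isClosed_range_sn hk, isOpen_range_sn hk⟩
    ⟨sn k 0, mem_image_of_mem _ (not_isPole_zero hk)⟩
  have hw : w ∈ sn k '' {t | ¬ IsPole k t} := h ▸ mem_univ w
  exact hw

theorem exists_cn_eq (w : ℂ) : ∃ t, ¬ IsPole k t ∧ cn k t = w := by
  obtain ⟨s, hs⟩ := IsAlgClosed.exists_pow_nat_eq (1 - w ^ 2) (n := 2) two_pos
  obtain ⟨t, ht, rfl⟩ := exists_sn_eq hk s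
  have h : cn k t ^ 2 = w ^ 2 := by linear_combination sn_sq_add_cn_sq hk ht - hs
  rcases sq_eq_sq_iff_eq_or_eq_neg.1 h with h | h
  · exact ⟨t, ht, h⟩
  · exact ⟨t + 2 * quarterPeriod k, by rwa [isPole_add_two_quarterPeriod hk],
      by rw [cn_add_two_quarterPeriod hk, h, neg_neg]⟩

end

/-! ### Parametrization of the biquadratic curves -/

/-- In the family `t ↦ (sn t, sn (t + s))` every point of the biquadratic curve occurs. For given
`sn t` the equation is quadratic in the second coordinate, with roots `sn (t ± s)`, and the
reflection `t ↦ 2K - t` turns `sn (t - s)` into `sn (t + s)`. The hypothesis `hdeg` deals with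
the points where the quadratic degenerates, i.e. where `t + s` or `t - s` may be a pole. -/
theorem isParametrizedBy_sn {k : ℝ} (hk : k ∈ Ioo (0 : ℝ) 1) {s : ℂ} (hs : ¬ IsPole k s)
    (hdeg : ∀ t v : ℂ, ¬ IsPole k t → 1 - (k : ℂ) ^ 2 * sn k t ^ 2 * sn k s ^ 2 = 0 →
      -(2 * cn k s * dn k s * sn k t * v) + sn k t ^ 2 - sn k s ^ 2 = 0 →
      (¬ IsPole k (t + s) ∧ v = sn k (t + s)) ∨ (¬ IsPole k (t - s) ∧ v = sn k (t - s))) :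
    IsParametrizedBy k (sn k)
      (fun u v => -((k : ℂ) ^ 2 * sn k s ^ 2) * (u ^ 2 * v ^ 2) + u ^ 2 + v ^ 2 + -(sn k s ^ 2)
        - 2 * (cn k s * dn k s) * (u * v)) 1 1 s := by
  intro u v
  simp only [one_mul]
  constructor
  · intro h
    obtain ⟨t, ht, rfl⟩ := exists_sn_eq hk u
    have hroot : (¬ IsPole k (t + s) ∧ v = sn k (t + s)) ∨
        (¬ IsPole k (t - s) ∧ v = sn k (t - s)) := by
      by_cases hD : 1 - (k : ℂ) ^ 2 * sn k t ^ 2 * sn k s ^ 2 = 0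
      · exact hdeg t v ht hD (by linear_combination h - v ^ 2 * hD)
      · have hns : ¬ IsPole k (-s) := by rwa [isPole_neg hk]
        have hp : ¬ IsPole k (t + s) := fun hp => hD (addition_den_eq_zero hk ht hs hp)
        have hm : ¬ IsPole k (t + -s) := fun hm => hD (by
          simpa [sn_neg hk] using addition_den_eq_zero hk ht hns hm)
        have a1 := sn_add_mul hk ht hs hp
        have a2 := sn_add_mul hk ht hns hm
        rw [sn_neg hk, cn_neg hk, dn_neg hk, neg_sq] at a2
        have e1 := sn_sq_add_cn_sq hk ht
        have e2 := sn_sq_add_cn_sq hk hs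
        have e3 := dn_sq hk ht
        have e4 := dn_sq hk hs
        have key : ((1 - (k : ℂ) ^ 2 * sn k t ^ 2 * sn k s ^ 2) * (v - sn k (t + s)))
            * ((1 - (k : ℂ) ^ 2 * sn k t ^ 2 * sn k s ^ 2) * (v - sn k (t + -s))) = 0 := by
          have r1 : (1 - (k : ℂ) ^ 2 * sn k t ^ 2 * sn k s ^ 2) * (v - sn k (t + s))
              = (1 - (k : ℂ) ^ 2 * sn k t ^ 2 * sn k s ^ 2) * v
                - (sn k t * cn k s * dn k s + sn k s * cn k t * dn k t) := by
            linear_combination -a1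
          have r2 : (1 - (k : ℂ) ^ 2 * sn k t ^ 2 * sn k s ^ 2) * (v - sn k (t + -s))
              = (1 - (k : ℂ) ^ 2 * sn k t ^ 2 * sn k s ^ 2) * v
                - (sn k t * cn k s * dn k s - sn k s * cn k t * dn k t) := by
            linear_combination -a2
          rw [r1, r2]
          linear_combination (1 - (k : ℂ) ^ 2 * sn k t ^ 2 * sn k s ^ 2) * h
            - sn k s ^ 2 * dn k t ^ 2 * e1 - sn k s ^ 2 * (1 - sn k t ^ 2) * e3
            + sn k t ^ 2 * dn k s ^ 2 * e2 + sn k t ^ 2 * (1 - sn k s ^ 2) * e4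
        rcases mul_eq_zero.1 key with h1 | h1
        · exact Or.inl ⟨hp, sub_eq_zero.1 ((mul_eq_zero.1 h1).resolve_left hD)⟩
        · exact Or.inr ⟨hm, sub_eq_zero.1 ((mul_eq_zero.1 h1).resolve_left hD)⟩
    rcases hroot with ⟨hp, hv⟩ | ⟨hm, hv⟩
    · exact ⟨t, ht, hp, rfl, hv⟩
    · have e : 2 * (quarterPeriod k : ℂ) - t + s = 2 * quarterPeriod k - (t - s) := by ring
      refine ⟨2 * quarterPeriod k - t, ?_, ?_, ?_, ?_⟩
      · rwa [isPole_two_quarterPeriod_sub hk]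
      · rwa [e, isPole_two_quarterPeriod_sub hk]
      · rw [sn_two_quarterPeriod_sub hk]
      · rw [e, sn_two_quarterPeriod_sub hk, hv]
  · rintro ⟨t, ht, hts, rfl, rfl⟩
    linear_combination sn_biquadratic hk ht hs hts

/-- The analogue of `isParametrizedBy_sn` for `cn`, with the reflection `t ↦ -t`. -/
theorem isParametrizedBy_cn {k : ℝ} (hk : k ∈ Ioo (0 : ℝ) 1) {s : ℂ} (hs : ¬ IsPole k s)
    (hdn : dn k s ≠ 0)
    (hdeg : ∀ t v : ℂ, ¬ IsPole k t → 1 - (k : ℂ) ^ 2 * sn k t ^ 2 * sn k s ^ 2 = 0 →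
      -(2 * cn k s * cn k t * v) + dn k s ^ 2 * cn k t ^ 2 + (k ^ 2 - 1) * sn k s ^ 2 = 0 →
      (¬ IsPole k (t + s) ∧ v = cn k (t + s)) ∨ (¬ IsPole k (t - s) ∧ v = cn k (t - s))) :
    IsParametrizedBy k (cn k)
      (fun u v => (k : ℂ) ^ 2 * sn k s ^ 2 / dn k s ^ 2 * (u ^ 2 * v ^ 2) + u ^ 2 + v ^ 2
        + ((k : ℂ) ^ 2 - 1) * sn k s ^ 2 / dn k s ^ 2
        - 2 * (cn k s / dn k s ^ 2) * (u * v)) 1 1 s := by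
  intro u v
  simp only [one_mul]
  have e4 := dn_sq hk hs
  -- Clearing the denominator `dn² s` gives the polynomial relation.
  have hclear : ∀ t : ℂ, ¬ IsPole k t → dn k s ^ 2
      * ((k : ℂ) ^ 2 * sn k s ^ 2 / dn k s ^ 2 * (cn k t ^ 2 * v ^ 2) + cn k t ^ 2 + v ^ 2
        + ((k : ℂ) ^ 2 - 1) * sn k s ^ 2 / dn k s ^ 2
        - 2 * (cn k s / dn k s ^ 2) * (cn k t * v))
      = (1 - k ^ 2 * sn k t ^ 2 * sn k s ^ 2) * v ^ 2
      - 2 * cn k s * cn k t * v + dn k s ^ 2 * cn k t ^ 2 + (k ^ 2 - 1) * sn k s ^ 2 :=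
    fun t ht => by
      have e1 := sn_sq_add_cn_sq hk ht
      field_simp
      linear_combination v ^ 2 * e4 + k ^ 2 * sn k s ^ 2 * v ^ 2 * e1
  constructor
  · intro h
    obtain ⟨t, ht, rfl⟩ := exists_cn_eq hk u
    have h := hclear t ht ▸ congrArg (dn k s ^ 2 * ·) h
    rw [mul_zero] at h
    have hroot : (¬ IsPole k (t + s) ∧ v = cn k (t + s)) ∨
        (¬ IsPole k (t - s) ∧ v = cn k (t - s)) := by
      by_cases hD : 1 - (k : ℂ) ^ 2 * sn k t ^ 2 * sn k s ^ 2 = 0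
      · exact hdeg t v ht hD (by linear_combination h - v ^ 2 * hD)
      · have hns : ¬ IsPole k (-s) := by rwa [isPole_neg hk]
        have hp : ¬ IsPole k (t + s) := fun hp => hD (addition_den_eq_zero hk ht hs hp)
        have hm : ¬ IsPole k (t + -s) := fun hm => hD (by
          simpa [sn_neg hk] using addition_den_eq_zero hk ht hns hm)
        have a1 := cn_add_mul hk ht hs hp
        have a2 := cn_add_mul hk ht hns hm
        rw [sn_neg hk, cn_neg hk, dn_neg hk, neg_sq] at a2
        have e1 := sn_sq_add_cn_sq hk ht
        have e2 := sn_sq_add_cn_sq hk hs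
        have e3 := dn_sq hk ht
        have key : ((1 - (k : ℂ) ^ 2 * sn k t ^ 2 * sn k s ^ 2) * (v - cn k (t + s)))
            * ((1 - (k : ℂ) ^ 2 * sn k t ^ 2 * sn k s ^ 2) * (v - cn k (t + -s))) = 0 := by
          have r1 : (1 - (k : ℂ) ^ 2 * sn k t ^ 2 * sn k s ^ 2) * (v - cn k (t + s))
              = (1 - (k : ℂ) ^ 2 * sn k t ^ 2 * sn k s ^ 2) * v
                - (cn k t * cn k s - sn k t * dn k t * sn k s * dn k s) := by
            linear_combination -a1
          have r2 : (1 - (k : ℂ) ^ 2 * sn k t ^ 2 * sn k s ^ 2) * (v - cn k (t + -s))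
              = (1 - (k : ℂ) ^ 2 * sn k t ^ 2 * sn k s ^ 2) * v
                - (cn k t * cn k s + sn k t * dn k t * sn k s * dn k s) := by
            linear_combination -a2
          rw [r1, r2]
          linear_combination (1 - (k : ℂ) ^ 2 * sn k t ^ 2 * sn k s ^ 2) * h
            - sn k t ^ 2 * sn k s ^ 2 * dn k s ^ 2 * e3
            - (sn k t ^ 2 * (1 - k ^ 2 * sn k t ^ 2) * sn k s ^ 2
              + (1 - k ^ 2 * sn k t ^ 2 * sn k s ^ 2) * cn k t ^ 2) * e4
            + cn k t ^ 2 * e2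
            - ((1 - k ^ 2 * sn k t ^ 2 * sn k s ^ 2) * (1 - k ^ 2 * sn k s ^ 2)
              - (1 - sn k s ^ 2)) * e1
        rcases mul_eq_zero.1 key with h1 | h1
        · exact Or.inl ⟨hp, sub_eq_zero.1 ((mul_eq_zero.1 h1).resolve_left hD)⟩
        · exact Or.inr ⟨hm, sub_eq_zero.1 ((mul_eq_zero.1 h1).resolve_left hD)⟩
    rcases hroot with ⟨hp, hv⟩ | ⟨hm, hv⟩
    · exact ⟨t, ht, hp, rfl, hv⟩
    · have e : -t + s = -(t - s) := by ring
      refine ⟨-t, ?_, ?_, ?_, ?_⟩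
      · rwa [isPole_neg hk]
      · rwa [e, isPole_neg hk]
      · rw [cn_neg hk]
      · rw [e, cn_neg hk, hv]
  · rintro ⟨t, ht, hts, rfl, rfl⟩
    refine (mul_eq_zero.1 ((hclear t ht).trans ?_)).resolve_left (pow_ne_zero 2 hdn)
    exact cn_biquadratic hk ht hs hts

/-- A parametrization is transported by rescaling the coordinates and the equation. -/
lemma IsParametrizedBy.rescale {k : ℝ} {φ : ℂ → ℂ} {Φ Ψ : ℂ → ℂ → ℂ} {s a b l : ℂ}
    (h : IsParametrizedBy k φ Φ 1 1 s) (ha : a ≠ 0) (hb : b ≠ 0) (hl : l ≠ 0)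
    (hΨ : ∀ u v, Ψ u v = l * Φ (u / a) (v / b)) : IsParametrizedBy k φ Ψ a b s := by
  intro u v
  rw [hΨ, mul_eq_zero_iff_left hl, h]
  simp only [one_mul, div_eq_iff ha, div_eq_iff hb, mul_comm a, mul_comm b]

/-! ### The shift by the quarter period -/

/-- The relation between `cn t` and `cn (t + K)`. Where the leading coefficient of the quadratic for
the second coordinate vanishes, the equation has no solution, so no degenerate points occur. -/
theorem isParametrizedBy_cn_quarterPeriod {k : ℝ} (hk : k ∈ Ioo (0 : ℝ) 1) :
    IsParametrizedBy k (cn k)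
      (fun u v => (k : ℂ) ^ 2 / (1 - (k : ℂ) ^ 2) * (u ^ 2 * v ^ 2) + u ^ 2 + v ^ 2 - 1) 1 1
      (quarterPeriod k) := by
  have hs := not_isPole_ofReal hk (quarterPeriod k)
  have e1 := sn_ofReal hk (quarterPeriod k)
  have e2 := cn_ofReal hk (quarterPeriod k)
  rw [snReal_quarterPeriod hk, Complex.ofReal_one] at e1
  rw [cnReal_quarterPeriod hk, Complex.ofReal_zero] at e2
  have e3 := dn_sq hk hs
  rw [e1, one_pow, mul_one] at e3
  have hk2 : 1 - (k : ℂ) ^ 2 ≠ 0 := by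
    exact_mod_cast (sub_pos.2 (sq_lt_one_of_modulus hk)).ne'
  have h := isParametrizedBy_cn hk hs (fun h0 => hk2 (by rw [← e3, h0]; ring))
    (fun t v ht hD h => by
      exfalso
      rw [e1, e2, e3] at h
      rw [e1] at hD
      have e5 := sn_sq_add_cn_sq hk ht
      exact hk2 (by linear_combination (1 - (k : ℂ) ^ 2) * hD - k ^ 2 * h
        + k ^ 2 * (1 - (k : ℂ) ^ 2) * e5))
  convert! h using 3 with u v
  rw [e1, e2, e3]
  field_simp
  ring

/-- The relation between `sn t` and `sn (t + K)`. -/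
theorem isParametrizedBy_sn_quarterPeriod {k : ℝ} (hk : k ∈ Ioo (0 : ℝ) 1) :
    IsParametrizedBy k (sn k)
      (fun u v => -(k : ℂ) ^ 2 * (u ^ 2 * v ^ 2) + u ^ 2 + v ^ 2 - 1) 1 1
      (quarterPeriod k) := by
  have hs := not_isPole_ofReal hk (quarterPeriod k)
  have e1 := sn_ofReal hk (quarterPeriod k)
  have e2 := cn_ofReal hk (quarterPeriod k)
  rw [snReal_quarterPeriod hk, Complex.ofReal_one] at e1
  rw [cnReal_quarterPeriod hk, Complex.ofReal_zero] at e2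
  have hk2 : 1 - (k : ℂ) ^ 2 ≠ 0 := by
    exact_mod_cast (sub_pos.2 (sq_lt_one_of_modulus hk)).ne'
  have h := isParametrizedBy_sn hk hs
    (fun t v ht hD h => by
      exfalso
      rw [e1, e2] at h
      rw [e1] at hD
      exact hk2 (by linear_combination hD + k ^ 2 * h))
  convert! h using 3 with u v
  rw [e1, e2]
  ring

/-! ### The segment from `0` to `iK'` -/

section

variable {k : ℝ} (hk : k ∈ Ioo (0 : ℝ) 1)
include hk

lemma not_isPole_of_mem_imagSegment {θ : ℂ} (hθ : θ ∈ imagSegment k) : ¬ IsPole k θ := by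
  obtain ⟨s, hs, rfl⟩ := hθ
  rw [isPole_iff hk]
  simp [(cnReal_pos (complModulus_mem hk) hs).ne']

lemma cn_mul_I {s : ℝ} (hs : s ∈ Ioo 0 (quarterPeriod (complModulus k))) :
    cn k (s * Complex.I) = ((1 / cnReal (complModulus k) s : ℝ) : ℂ) := by
  have h : (cnReal (complModulus k) s : ℂ) ≠ 0 :=
    Complex.ofReal_ne_zero.2 (cnReal_pos (complModulus_mem hk) hs).ne'
  simp [cn, jacobiDen, snReal_zero hk, cnReal_zero hk]
  field_simp

lemma dn_mul_I {s : ℝ} (hs : s ∈ Ioo 0 (quarterPeriod (complModulus k))) :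
    dn k (s * Complex.I)
      = ((dnReal (complModulus k) s / cnReal (complModulus k) s : ℝ) : ℂ) := by
  have h : (cnReal (complModulus k) s : ℂ) ≠ 0 :=
    Complex.ofReal_ne_zero.2 (cnReal_pos (complModulus_mem hk) hs).ne'
  simp [dn, jacobiDen, snReal_zero hk, cnReal_zero hk, dnReal_zero hk]
  field_simp

/-- On the segment `cn` and `dn` take positive real values. -/
lemma exists_pos_cn_dn_eq {θ : ℂ} (hθ : θ ∈ imagSegment k) :
    ∃ c d : ℝ, 0 < c ∧ 0 < d ∧ cn k θ = c ∧ dn k θ = d ∧ sn k θ ^ 2 = ((1 - c ^ 2 : ℝ) : ℂ) ∧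
      d ^ 2 = 1 - k ^ 2 * (1 - c ^ 2) := by
  have hp := not_isPole_of_mem_imagSegment hk hθ
  obtain ⟨s, hs, rfl⟩ := hθ
  have hc := cnReal_pos (complModulus_mem hk) hs
  have hd := dnReal_pos (complModulus_mem hk) s
  have e1 := sn_sq_add_cn_sq hk hp
  have e2 := dn_sq hk hp
  rw [cn_mul_I hk hs] at e1
  rw [dn_mul_I hk hs] at e2
  have hsn : sn k (s * Complex.I) ^ 2 = ((1 - (1 / cnReal (complModulus k) s) ^ 2 : ℝ) : ℂ) := by
    push_cast at e1 ⊢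
    linear_combination e1
  refine ⟨_, _, by positivity, by positivity, cn_mul_I hk hs, dn_mul_I hk hs, hsn, ?_⟩
  rw [hsn] at e2
  exact_mod_cast e2

/-- `dn` maps the segment from `0` to `iK'` bijectively onto `(1, ∞)`. -/
lemma existsUnique_dn_eq {r : ℝ} (hr : 1 < r) :
    ∃! θ : ℂ, θ ∈ imagSegment k ∧ dn k θ = r := by
  have hk' := complModulus_mem hk
  have hk2 := sq_lt_one_of_modulus hk
  have hr2 : 1 < r ^ 2 := by nlinarith
  have hden : 0 < r ^ 2 - complModulus k ^ 2 := by nlinarith [sq_lt_one_of_modulus hk']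
  -- With `S = sn² (s; k')` the equation reads `(1 - k'² S) / (1 - S) = r²`.
  have hS : √((r ^ 2 - 1) / (r ^ 2 - complModulus k ^ 2)) ∈ Ioo (0 : ℝ) 1 := by
    refine ⟨Real.sqrt_pos.2 (div_pos (by linarith) hden), ?_⟩
    rw [Real.sqrt_lt' one_pos, one_pow, div_lt_one hden]
    linarith [sq_lt_one_of_modulus hk']
  have hiff : ∀ s ∈ Ioo 0 (quarterPeriod (complModulus k)), dn k (s * Complex.I) = r ↔
      snReal (complModulus k) s = √((r ^ 2 - 1) / (r ^ 2 - complModulus k ^ 2)) := fun s hs => by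
    have hc := cnReal_pos hk' hs
    have hd := dnReal_pos hk' s
    have e1 := snReal_sq_add_cnReal_sq (complModulus k) s
    have e2 := dnReal_sq hk' s
    rw [dn_mul_I hk hs, Complex.ofReal_inj, eq_comm (b := √_),
      Real.sqrt_eq_iff_eq_sq (div_nonneg (by linarith) hden.le) (snReal_mem_Ioo hk' hs).1.le,
      ← sq_eq_sq₀ (div_pos hd hc).le (by linarith), div_pow, div_eq_iff (by positivity),
      div_eq_iff hden.ne', e2, eq_sub_iff_add_eq.2 ((add_comm _ _).trans e1)]
    constructor <;> intro h <;> linarith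
  obtain ⟨s, ⟨hs, hsS⟩, huniq⟩ := existsUnique_snReal_eq hk' hS
  refine ⟨s * Complex.I, ⟨⟨s, hs, rfl⟩, (hiff s hs).2 hsS⟩, ?_⟩
  rintro _ ⟨⟨y, hy, rfl⟩, hyr⟩
  rw [huniq y ⟨hy, (hiff y hy).1 hyr⟩]

/-- The number `2θ` is not a difference of poles. -/
lemma not_isPole_add_or_sub {θ : ℂ} (hθ : θ ∈ imagSegment k) (t : ℂ) :
    ¬ IsPole k (t + θ) ∨ ¬ IsPole k (t - θ) := by
  obtain ⟨s, hs, rfl⟩ := hθ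
  by_contra! h
  have h1 := ((isPole_iff hk).1 h.1).2
  have h2 := ((isPole_iff hk).1 h.2).2
  simp only [Complex.add_im, Complex.sub_im, Complex.mul_I_im, Complex.ofReal_re] at h1 h2
  exact cnReal_ne_zero_of_lt (complModulus_mem hk) h2 (by linarith [hs.1]) (by linarith [hs.2]) h1

/-- For `θ` on the segment the relation between `sn t` and `sn (t - θ)` describes exactly the
points `(sn t, sn (t - θ))`. Where it degenerates to a linear equation for the second coordinate,
one of `t + θ`, `t - θ` is a pole and the other one gives the unique root. -/
theorem isParametrizedBy_sn_of_mem_imagSegment {θ : ℂ} (hθ : θ ∈ imagSegment k) :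
    IsParametrizedBy k (sn k)
      (fun u v => -((k : ℂ) ^ 2 * sn k θ ^ 2) * (u ^ 2 * v ^ 2) + u ^ 2 + v ^ 2 + -(sn k θ ^ 2)
        - 2 * (cn k θ * dn k θ) * (u * v)) 1 1 (-θ) := by
  have hp := not_isPole_of_mem_imagSegment hk hθ
  have hn : ¬ IsPole k (-θ) := by rwa [isPole_neg hk]
  obtain ⟨c, d, hc, hd, hcn, hdn, -, -⟩ := exists_pos_cn_dn_eq hk hθ
  have h := isParametrizedBy_sn hk hn (fun t v ht hD h => by
    rw [cn_neg hk, dn_neg hk, sn_neg hk, neg_sq] at h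
    rw [sn_neg hk, neg_sq] at hD
    have hsn : sn k t ≠ 0 := fun h0 => by simp [h0] at hD
    have hne : 2 * cn k θ * dn k θ * sn k t ≠ 0 := by
      rw [hcn, hdn]
      exact mul_ne_zero (mul_ne_zero (mul_ne_zero two_ne_zero (Complex.ofReal_ne_zero.2 hc.ne'))
        (Complex.ofReal_ne_zero.2 hd.ne')) hsn
    rw [sub_neg_eq_add, ← sub_eq_add_neg]
    rcases (not_isPole_add_or_sub hk hθ t).symm with hm | hm
    · refine Or.inl ⟨hm, mul_left_cancel₀ hne ?_⟩
      have hb := sn_biquadratic hk ht hn (by rwa [← sub_eq_add_neg])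
      rw [cn_neg hk, dn_neg hk, sn_neg hk, neg_sq, ← sub_eq_add_neg] at hb
      linear_combination hb - h - sn k (t - θ) ^ 2 * hD
    · refine Or.inr ⟨hm, mul_left_cancel₀ hne ?_⟩
      have hb := sn_biquadratic hk ht hp hm
      linear_combination hb - h - sn k (t + θ) ^ 2 * hD)
  simpa only [cn_neg hk, dn_neg hk, sn_neg hk, neg_sq] using h

/-- The analogue of `isParametrizedBy_sn_of_mem_imagSegment` for `cn`. -/
theorem isParametrizedBy_cn_of_mem_imagSegment {θ : ℂ} (hθ : θ ∈ imagSegment k) :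
    IsParametrizedBy k (cn k)
      (fun u v => (k : ℂ) ^ 2 * sn k θ ^ 2 / dn k θ ^ 2 * (u ^ 2 * v ^ 2) + u ^ 2 + v ^ 2
        + ((k : ℂ) ^ 2 - 1) * sn k θ ^ 2 / dn k θ ^ 2
        - 2 * (cn k θ / dn k θ ^ 2) * (u * v)) 1 1 (-θ) := by
  have hp := not_isPole_of_mem_imagSegment hk hθ
  have hn : ¬ IsPole k (-θ) := by rwa [isPole_neg hk]
  obtain ⟨c, d, hc, hd, hcn, hdn, -, -⟩ := exists_pos_cn_dn_eq hk hθ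
  have hc0 : cn k θ ≠ 0 := hcn ▸ Complex.ofReal_ne_zero.2 hc.ne'
  have hd0 : dn k θ ≠ 0 := hdn ▸ Complex.ofReal_ne_zero.2 hd.ne'
  have h := isParametrizedBy_cn hk hn (by rwa [dn_neg hk]) (fun t v ht hD h => by
    rw [cn_neg hk, dn_neg hk, sn_neg hk, neg_sq] at h
    rw [sn_neg hk, neg_sq] at hD
    have hcn : cn k t ≠ 0 := fun h0 => by
      have e1 := sn_sq_add_cn_sq hk ht
      have e2 := dn_sq hk hp
      rw [h0] at e1
      refine pow_ne_zero 2 hd0 ?_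
      linear_combination hD + e2 + k ^ 2 * sn k θ ^ 2 * e1
    have hne : 2 * cn k θ * cn k t ≠ 0 := mul_ne_zero (mul_ne_zero two_ne_zero hc0) hcn
    rw [sub_neg_eq_add, ← sub_eq_add_neg]
    rcases (not_isPole_add_or_sub hk hθ t).symm with hm | hm
    · refine Or.inl ⟨hm, mul_left_cancel₀ hne ?_⟩
      have hb := cn_biquadratic hk ht hn (by rwa [← sub_eq_add_neg])
      rw [cn_neg hk, dn_neg hk, sn_neg hk, neg_sq, ← sub_eq_add_neg] at hb
      linear_combination hb - h - cn k (t - θ) ^ 2 * hD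
    · refine Or.inr ⟨hm, mul_left_cancel₀ hne ?_⟩
      have hb := cn_biquadratic hk ht hp hm
      linear_combination hb - h - cn k (t + θ) ^ 2 * hD)
  simpa only [cn_neg hk, dn_neg hk, sn_neg hk, neg_sq] using h

end

/-! ### Trigonometry of the sector angles -/

lemma semi_rotate (α β γ δ : ℝ) : semi β γ δ α = semi α β γ δ := by
  simp only [semi]; ring

lemma IsSectorAngles.rotate {α β γ δ : ℝ} (h : IsSectorAngles α β γ δ) :
    IsSectorAngles δ α β γ where
  mem_α := h.mem_δ
  mem_β := h.mem_α
  mem_γ := h.mem_β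
  mem_δ := h.mem_γ
  lt_α := h.lt_δ
  lt_β := h.lt_α
  lt_γ := h.lt_β
  lt_δ := h.lt_γ

/-- `sin x sin y - sin (s - x) sin (s - y)` in product form. -/
lemma sin_mul_sin_sub (s x y : ℝ) :
    sin x * sin y - sin (s - x) * sin (s - y) = -(sin s * sin (s - x - y)) := by
  obtain ⟨p, rfl⟩ : ∃ p, s = p + x + y := ⟨s - x - y, by ring⟩
  rw [show p + x + y - x = p + y by ring, show p + x + y - y = p + x by ring,
    show p + y - y = p by ring]
  simp only [sin_add, cos_add]
  linear_combination -(sin x * sin y) * sin_sq_add_cos_sq p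

/-- The sines of a spherical four-bar linkage of elliptic type and the relations between them:
`a, b, c, d` are the sines of `σ - α, …, σ - δ`, and `s, u, v, w` those of `σ`, `σ - α - β`,
`σ - α - γ`, `σ - α - δ`. -/
structure SineRelations (A B C D a b c d s u v w : ℝ) : Prop where
  hA : 0 < A
  hB : 0 < B
  hC : 0 < C
  hD : 0 < D
  ha : 0 < a
  hb : 0 < b
  hc : 0 < c
  hd : 0 < d
  hs : s ≠ 0
  hu : u ≠ 0
  hv : v ≠ 0
  hw : w ≠ 0
  hAB : A * B = a * b - s * u
  hCD : C * D = c * d + s * u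
  hBC : B * C = b * c + s * w
  hAC : A * C = a * c - s * v
  hBD : B * D = b * d + s * v
  hE : a * c - B * D = -(u * w)
  hM : A * B * C * D = a * b * c * d - s * u * v * w

section

variable {α β γ δ : ℝ}

lemma semi_sub_eq (α β γ δ : ℝ) :
    semi α β γ δ - β - δ = -(semi α β γ δ - α - γ) ∧
    semi α β γ δ - γ - δ = -(semi α β γ δ - α - β) ∧
    semi α β γ δ - β - γ = -(semi α β γ δ - α - δ) := by
  simp only [semi]
  refine ⟨?_, ?_, ?_⟩ <;> ring

/-- All the relations are instances of `sin_mul_sin_sub`, because `σ` is half the sum of the angles;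
the elliptic type gives the nonvanishing of `s, u, v, w`. -/
lemma IsSectorAngles.sineRelations (h : IsSectorAngles α β γ δ) (hell : IsElliptic α β γ δ) :
    SineRelations (sin α) (sin β) (sin γ) (sin δ) (sin (semi α β γ δ - α))
      (sin (semi α β γ δ - β)) (sin (semi α β γ δ - γ)) (sin (semi α β γ δ - δ))
      (sin (semi α β γ δ)) (sin (semi α β γ δ - α - β)) (sin (semi α β γ δ - α - γ))
      (sin (semi α β γ δ - α - δ)) := by
  obtain ⟨n1, n2, n3, n4⟩ := hell
  obtain ⟨h1, h2, h3, h4, h5, h6, h7, h8⟩ := h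
  obtain ⟨t1, t2, t3⟩ := semi_sub_eq α β γ δ
  have hσ : 2 * semi α β γ δ = α + β + γ + δ := by simp only [semi]; ring
  rw [f22, t1, sin_neg] at n1
  rw [f02, t2, sin_neg] at n3
  rw [f20] at n2
  rw [f00] at n4
  set σ := semi α β γ δ
  have rAB : sin α * sin β = sin (σ - α) * sin (σ - β) - sin σ * sin (σ - α - β) := by
    linear_combination sin_mul_sin_sub σ α β
  have rAC : sin α * sin γ = sin (σ - α) * sin (σ - γ) - sin σ * sin (σ - α - γ) := by
    linear_combination sin_mul_sin_sub σ α γ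
  have rBD : sin β * sin δ = sin (σ - β) * sin (σ - δ) + sin σ * sin (σ - α - γ) := by
    have := sin_mul_sin_sub σ β δ
    rw [t1, sin_neg] at this
    linear_combination this
  have rCD : sin γ * sin δ = sin (σ - γ) * sin (σ - δ) + sin σ * sin (σ - α - β) := by
    have := sin_mul_sin_sub σ γ δ
    rw [t2, sin_neg] at this
    linear_combination this
  have rBC : sin β * sin γ = sin (σ - β) * sin (σ - γ) + sin σ * sin (σ - α - δ) := by
    have := sin_mul_sin_sub σ β γ
    rw [t3, sin_neg] at this
    linear_combination this
  have rE : sin (σ - α) * sin (σ - γ) - sin β * sin δ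
      = -(sin (σ - α - β) * sin (σ - α - δ)) := by
    have := sin_mul_sin_sub (σ - α - β) (σ - α) (-(σ - γ))
    rw [show σ - α - β - (σ - α) = -β by ring,
      show σ - α - β - -(σ - γ) = δ by linear_combination hσ,
      show -β - -(σ - γ) = -(σ - α - δ) by linear_combination hσ] at this
    simp only [sin_neg] at this
    linear_combination -this
  have rF : sin α * sin β - sin (σ - γ) * sin (σ - δ)
      = -(sin (σ - α - γ) * sin (σ - α - δ)) := by
    have := sin_mul_sin_sub (σ - α - γ) (-α) β
    rw [show σ - α - γ - -α = σ - γ by ring,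
      show σ - α - γ - β = -(σ - δ) by linear_combination hσ,
      show σ - γ - β = -(σ - α - δ) by linear_combination hσ] at this
    simp only [sin_neg] at this
    linear_combination -this
  refine ⟨sin_pos_of_mem_Ioo h1, sin_pos_of_mem_Ioo h2, sin_pos_of_mem_Ioo h3,
    sin_pos_of_mem_Ioo h4, sin_pos_of_mem_Ioo ⟨by linarith, by linarith⟩,
    sin_pos_of_mem_Ioo ⟨by linarith, by linarith⟩, sin_pos_of_mem_Ioo ⟨by linarith, by linarith⟩,
    sin_pos_of_mem_Ioo ⟨by linarith, by linarith⟩, left_ne_zero_of_mul n4,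
    neg_ne_zero.1 (right_ne_zero_of_mul n3), neg_ne_zero.1 (right_ne_zero_of_mul n1),
    right_ne_zero_of_mul n2, rAB, rCD, rBC, rAC, rBD, rE, ?_⟩
  linear_combination (sin α * sin β) * rCD + (sin (σ - γ) * sin (σ - δ)) * rAB
    + (sin σ * sin (σ - α - β)) * rF

lemma IsSectorAngles.semi_mem (h : IsSectorAngles α β γ δ) : semi α β γ δ ∈ Ioo 0 (2 * π) := by
  obtain ⟨⟨h1, _⟩, ⟨h2, _⟩, ⟨h3, _⟩, ⟨h4, _⟩, h5, h6, h7, h8⟩ := h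
  simp only [semi]
  constructor <;> linarith

lemma IsSectorAngles.sin_semi_pos_iff (h : IsSectorAngles α β γ δ) :
    0 < sin (semi α β γ δ) ↔ semi α β γ δ < π := by
  have hσ := h.semi_mem
  refine ⟨fun hs => ?_, fun hs => sin_pos_of_mem_Ioo ⟨hσ.1, hs⟩⟩
  by_contra! hle
  have := sin_nonneg_of_nonneg_of_le_pi (x := semi α β γ δ - π) (by linarith) (by linarith [hσ.2])
  rw [sin_sub_pi] at this
  linarith

/-- The sign of a sine of an angle in `(-π, π)` is the sign of the angle. -/
lemma sin_pos_iff_of_abs_lt_pi {x : ℝ} (h1 : -π < x) (h2 : x < π) : 0 < sin x ↔ 0 < x := by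
  refine ⟨fun hs => ?_, fun hx => sin_pos_of_pos_of_lt_pi hx h2⟩
  by_contra! hle
  linarith [sin_nonpos_of_nonpos_of_neg_pi_le hle h1.le]

lemma IsSectorAngles.sin_opposite_pos_iff (h : IsSectorAngles α β γ δ) :
    0 < sin (semi α β γ δ - α - γ) ↔ α + γ < semi α β γ δ := by
  obtain ⟨⟨a1, b1⟩, ⟨a2, b2⟩, ⟨a3, b3⟩, ⟨a4, b4⟩, -⟩ := h
  rw [sin_pos_iff_of_abs_lt_pi, sub_sub, sub_pos]
  all_goals simp only [semi]; linarith

lemma IsSectorAngles.sin_adjacent_pos_iff (h : IsSectorAngles α β γ δ) :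
    0 < sin (semi α β γ δ - α - β) ↔ α + β < semi α β γ δ := by
  obtain ⟨⟨a1, b1⟩, ⟨a2, b2⟩, ⟨a3, b3⟩, ⟨a4, b4⟩, -⟩ := h
  rw [sin_pos_iff_of_abs_lt_pi, sub_sub, sub_pos]
  all_goals simp only [semi]; linarith

/-- The two hypotheses on `σ` and `α + γ` say that `sin σ` and
`sin (σ - α - γ)` have the same sign. -/
lemma IsSectorAngles.sin_mul_sin_pos (h : IsSectorAngles α β γ δ)
    (hc : (semi α β γ δ < π ∧ α + γ < semi α β γ δ) ∨ (π < semi α β γ δ ∧ semi α β γ δ < α + γ))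
    (hs : sin (semi α β γ δ) ≠ 0) (hv : sin (semi α β γ δ - α - γ) ≠ 0) :
    0 < sin (semi α β γ δ) * sin (semi α β γ δ - α - γ) := by
  rcases hc with ⟨h1, h2⟩ | ⟨h1, h2⟩
  · exact mul_pos (h.sin_semi_pos_iff.2 h1) (h.sin_opposite_pos_iff.2 h2)
  · refine mul_pos_of_neg_of_neg (lt_of_le_of_ne ?_ hs) (lt_of_le_of_ne ?_ hv)
    · exact not_lt.1 fun h' => absurd (h.sin_semi_pos_iff.1 h') (by linarith)
    · exact not_lt.1 fun h' => absurd (h.sin_opposite_pos_iff.1 h') (by linarith)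

lemma IsSectorAngles.sin_mul_sin_neg (h : IsSectorAngles α β γ δ)
    (hc : (semi α β γ δ < π ∧ semi α β γ δ < α + γ) ∨ (π < semi α β γ δ ∧ α + γ < semi α β γ δ))
    (hs : sin (semi α β γ δ) ≠ 0) (hv : sin (semi α β γ δ - α - γ) ≠ 0) :
    sin (semi α β γ δ) * sin (semi α β γ δ - α - γ) < 0 := by
  rcases hc with ⟨h1, h2⟩ | ⟨h1, h2⟩
  · refine mul_neg_of_pos_of_neg (h.sin_semi_pos_iff.2 h1) (lt_of_le_of_ne ?_ hv)
    exact not_lt.1 fun h' => absurd (h.sin_opposite_pos_iff.1 h') (by linarith)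
  · refine mul_neg_of_neg_of_pos (lt_of_le_of_ne ?_ hs) (h.sin_opposite_pos_iff.2 h2)
    exact not_lt.1 fun h' => absurd (h.sin_semi_pos_iff.1 h') (by linarith)

lemma IsElliptic.rotate (h : IsElliptic α β γ δ) : IsElliptic δ α β γ := by
  obtain ⟨t1, t2, t3⟩ := semi_sub_eq α β γ δ
  obtain ⟨n1, n2, n3, n4⟩ := h
  rw [f22, t1, sin_neg] at n1
  rw [f02, t2, sin_neg] at n3
  rw [f20] at n2
  rw [f00] at n4
  have hsm : semi δ α β γ = semi α β γ δ := (semi_rotate δ α β γ).symm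
  have a1 := left_ne_zero_of_mul n2
  have a2 := left_ne_zero_of_mul n1
  have a3 := left_ne_zero_of_mul n3
  have a4 := right_ne_zero_of_mul n4
  have a5 := right_ne_zero_of_mul n1
  have a6 := right_ne_zero_of_mul n2
  have a7 := right_ne_zero_of_mul n3
  rw [IsElliptic, f22, f20, f02, f00, hsm, sub_right_comm _ δ γ, t2, t3, sin_neg, sin_neg]
  exact ⟨mul_ne_zero a1 (neg_ne_zero.1 a5), mul_ne_zero a4 a7, mul_ne_zero a2 (neg_ne_zero.2 a6),
    mul_ne_zero (left_ne_zero_of_mul n4) a3⟩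

/-! ### Square roots and amplitudes -/

lemma csqrt_sq (x : ℝ) : csqrt x ^ 2 = x := by
  rw [csqrt]
  split_ifs with h
  · exact_mod_cast Real.sq_sqrt h
  · rw [mul_pow, Complex.I_sq, ← Complex.ofReal_pow, Real.sq_sqrt (by linarith)]
    push_cast
    ring

lemma csqrt_of_nonneg {x : ℝ} (h : 0 ≤ x) : csqrt x = (√x : ℝ) := if_pos h

lemma csqrt_of_neg {x : ℝ} (h : x < 0) : csqrt x = Complex.I * (√(-x) : ℝ) := if_neg h.not_ge

end

namespace SineRelations

variable {A B C D a b c d s u v w : ℝ} (R : SineRelations A B C D a b c d s u v w)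
include R

lemma amp_x : A * B / (a * b) - 1 = -(s * u) / (a * b) := by
  have := R.ha
  have := R.hb
  rw [R.hAB]
  field_simp
  ring

lemma amp_y : B * C / (b * c) - 1 = s * w / (b * c) := by
  have := R.hb
  have := R.hc
  rw [R.hBC]
  field_simp
  ring

lemma amp_z : C * D / (c * d) - 1 = s * u / (c * d) := by
  have := R.hc
  have := R.hd
  rw [R.hCD]
  field_simp
  ring

lemma ratio_sub_one : A * B * C * D / (a * b * c * d) - 1 = -(s * u * v * w) / (a * b * c * d) := by
  have := R.ha
  have := R.hb
  have := R.hc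
  have := R.hd
  rw [R.hM]
  field_simp
  ring

/-- If `u w < 0`, then `p_x` and `p_y` are both real or both imaginary. Their product is real,
and its sign relative to that of `-s u w` is the sign of `-u`; the latter is `adjSign`. -/
lemma amp_mul_amp (huw : u * w < 0) :
    (if u < 0 then 1 else -1 : ℂ) * (csqrt (A * B / (a * b) - 1) * csqrt (B * C / (b * c) - 1))
      * csqrt (a * c * (a * c - B * D)) = ((-(s * u * w) / b : ℝ) : ℂ) := by
  have ha := R.ha
  have hb := R.hb
  have hc := R.hc
  have hE : 0 ≤ a * c * (a * c - B * D) := by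
    rw [R.hE]
    exact mul_nonneg (mul_pos ha hc).le (by linarith)
  have hprod : ∀ x y : ℝ, 0 ≤ x → 0 ≤ y → x * y = -(s ^ 2 * (u * w)) / (a * b * (b * c)) →
      √x * √y * √(a * c * (a * c - B * D)) = |s| * -(u * w) / b := fun x y hx hy hxy => by
    rw [← Real.sqrt_mul hx, ← Real.sqrt_mul (mul_nonneg hx hy), hxy, R.hE,
      ← Real.sqrt_sq (div_nonneg (mul_nonneg (abs_nonneg s) (by linarith : 0 ≤ -(u * w))) hb.le)]
    congr 1
    rw [div_pow, mul_pow, sq_abs]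
    field_simp
  rw [R.amp_x, R.amp_y, csqrt_of_nonneg hE]
  rcases lt_or_gt_of_ne R.hs with hs | hs <;> rcases lt_or_gt_of_ne R.hu with hu | hu
  · have hw : 0 < w := by by_contra! h; nlinarith
    have h1 : -(s * u) / (a * b) < 0 :=
      div_neg_of_neg_of_pos (by linarith [mul_pos_of_neg_of_neg hs hu]) (by positivity)
    have h2 : s * w / (b * c) < 0 :=
      div_neg_of_neg_of_pos (mul_neg_of_neg_of_pos hs hw) (by positivity)
    have h := hprod _ _ (neg_nonneg.2 h1.le) (neg_nonneg.2 h2.le) (by field_simp)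
    rw [csqrt_of_neg h1, csqrt_of_neg h2, if_pos hu]
    rw [abs_of_neg hs] at h
    have h' := congrArg (fun x : ℝ => (x : ℂ)) h
    push_cast at h' ⊢
    linear_combination -h' + (√(-(-(s * u) / (a * b))) * √(-(s * w / (b * c)))
      * √(a * c * (a * c - B * D)) : ℂ) * Complex.I_sq
  · have hw : w < 0 := by by_contra! h; nlinarith
    have h1 : 0 ≤ -(s * u) / (a * b) :=
      div_nonneg (by linarith [mul_neg_of_neg_of_pos hs hu]) (by positivity)
    have h2 : 0 ≤ s * w / (b * c) :=
      div_nonneg (mul_pos_of_neg_of_neg hs hw).le (by positivity)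
    have h := hprod _ _ h1 h2 (by field_simp)
    rw [csqrt_of_nonneg h1, csqrt_of_nonneg h2, if_neg hu.not_gt]
    rw [abs_of_neg hs] at h
    have h' := congrArg (fun x : ℝ => (x : ℂ)) h
    push_cast at h' ⊢
    linear_combination -h'
  · have hw : 0 < w := by by_contra! h; nlinarith
    have h1 : 0 ≤ -(s * u) / (a * b) :=
      div_nonneg (by linarith [mul_neg_of_pos_of_neg hs hu]) (by positivity)
    have h2 : 0 ≤ s * w / (b * c) :=
      div_nonneg (mul_pos hs hw).le (by positivity)
    have h := hprod _ _ h1 h2 (by field_simp)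
    rw [csqrt_of_nonneg h1, csqrt_of_nonneg h2, if_pos hu]
    rw [abs_of_pos hs] at h
    have h' := congrArg (fun x : ℝ => (x : ℂ)) h
    push_cast at h' ⊢
    linear_combination h'
  · have hw : w < 0 := by by_contra! h; nlinarith
    have h1 : -(s * u) / (a * b) < 0 :=
      div_neg_of_neg_of_pos (by linarith [mul_pos hs hu]) (by positivity)
    have h2 : s * w / (b * c) < 0 :=
      div_neg_of_neg_of_pos (mul_neg_of_pos_of_neg hs hw) (by positivity)
    have h := hprod _ _ (neg_nonneg.2 h1.le) (neg_nonneg.2 h2.le) (by field_simp)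
    rw [csqrt_of_neg h1, csqrt_of_neg h2, if_neg hu.not_gt]
    rw [abs_of_pos hs] at h
    have h' := congrArg (fun x : ℝ => (x : ℂ)) h
    push_cast at h' ⊢
    linear_combination h' - (√(-(-(s * u) / (a * b))) * √(-(s * w / (b * c)))
      * √(a * c * (a * c - B * D)) : ℂ) * Complex.I_sq

/-- The phase equations in the case of `cn`, for the real values `x = cn θ` and `y = dn θ`. All
three of them amount to the value of `y`. -/
lemma cn_phase_iff {k x y : ℝ} (hk : k ^ 2 = 1 - 1 / (A * B * C * D / (a * b * c * d)))
    (huw : u * w < 0) (hx : 0 < x) (hy : 0 < y) (hxy : y ^ 2 = 1 - k ^ 2 * (1 - x ^ 2)) :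
    (k ^ 2 * (1 - x ^ 2) / y ^ 2 = A * C / (a * c) - 1 ∧
      x / y ^ 2 = A * C / √(a * c * (a * c - B * D)) ∧
      (k ^ 2 - 1) * (1 - x ^ 2) / y ^ 2 = b * d / (a * c - B * D)) ↔
    y = √(a * c / (A * C)) := by
  have hA := R.hA
  have hB := R.hB
  have hC := R.hC
  have hD := R.hD
  have ha := R.ha
  have hb := R.hb
  have hc := R.hc
  have hd := R.hd
  have hE : 0 < a * c - B * D := by rw [R.hE]; linarith
  have hsv : s * v ≠ 0 := mul_ne_zero R.hs R.hv
  have hsq : y = √(a * c / (A * C)) ↔ y ^ 2 * (A * C) = a * c := by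
    rw [eq_comm, Real.sqrt_eq_iff_eq_sq (by positivity) hy.le, div_eq_iff (by positivity), eq_comm]
  rw [hsq]
  constructor
  · rintro ⟨h1, -, -⟩
    rw [show k ^ 2 * (1 - x ^ 2) = 1 - y ^ 2 by linarith, sub_div, div_self (by positivity),
      sub_left_inj, div_eq_div_iff (by positivity) (by positivity)] at h1
    linarith
  · intro h
    have hk' : k ^ 2 * (A * B * C * D) = -(s * u * v * w) := by
      rw [hk]
      field_simp
      linear_combination R.hM
    -- The two expressions for `1 - y²` determine `x`.
    have hX : (1 - x ^ 2) * (u * w) = B * D := by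
      refine mul_left_cancel₀ hsv ?_
      linear_combination (1 - x ^ 2) * hk' - A * B * C * D * hxy + B * D * h - B * D * R.hAC
    have hx2 : x ^ 2 * (a * c - B * D) = a * c := by
      linear_combination hX + (x ^ 2 - 1) * R.hE
    have hx1 : x * √(a * c * (a * c - B * D)) = a * c := by
      rw [← sq_eq_sq₀ (by positivity) (by positivity), mul_pow, Real.sq_sqrt (by positivity)]
      linear_combination (a * c) * hx2
    refine ⟨?_, ?_, ?_⟩
    · rw [div_sub_one (by positivity), div_eq_div_iff (by positivity) (by positivity)]
      linear_combination (a * c) * hxy - h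
    · rw [div_eq_div_iff (by positivity) (by positivity), hx1]
      linear_combination -h
    · rw [div_eq_div_iff (by positivity) hE.ne']
      have hk1 : (k ^ 2 - 1) * (A * B * C * D) = -(a * b * c * d) := by
        linear_combination hk' - R.hM
      refine mul_left_cancel₀ (by positivity : A * B * C * D ≠ 0) ?_
      linear_combination (1 - x ^ 2) * (a * c - B * D) * hk1 - (b * d) * B * D * h
        + (a * b * c * d) * hx2

/-- The phase equations in the case of `sn`, for the real values `x = cn θ` and `y = dn θ`. -/
lemma sn_phase_iff {k x y : ℝ} (hk : k ^ 2 = 1 - A * B * C * D / (a * b * c * d))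
    (huw : u * w < 0) (hx : 0 < x) (hy : 0 < y) (hxy : y ^ 2 = 1 - k ^ 2 * (1 - x ^ 2)) :
    (-(k ^ 2 * (1 - x ^ 2)) = A * C / (a * c) - 1 ∧
      x * y = A * C / √(a * c * (a * c - B * D)) ∧
      -(1 - x ^ 2) = b * d / (a * c - B * D)) ↔
    y = √(A * C / (a * c)) := by
  have hA := R.hA
  have hC := R.hC
  have ha := R.ha
  have hb := R.hb
  have hc := R.hc
  have hd := R.hd
  have hE : 0 < a * c - B * D := by rw [R.hE]; linarith
  have hsv : s * v ≠ 0 := mul_ne_zero R.hs R.hv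
  have hsq : y = √(A * C / (a * c)) ↔ y ^ 2 * (a * c) = A * C := by
    rw [eq_comm, Real.sqrt_eq_iff_eq_sq (by positivity) hy.le, div_eq_iff (by positivity), eq_comm]
  rw [hsq]
  constructor
  · rintro ⟨h1, -, -⟩
    rw [div_sub_one (by positivity), eq_div_iff (by positivity)] at h1
    linear_combination (a * c) * hxy + h1
  · intro h
    have hk' : k ^ 2 * (a * b * c * d) = s * u * v * w := by
      rw [hk]
      field_simp
      linear_combination -R.hM
    -- The two expressions for `1 - y²` determine `x`.
    have hX : (1 - x ^ 2) * (u * w) = b * d := by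
      refine mul_left_cancel₀ hsv ?_
      linear_combination -(1 - x ^ 2) * hk' + a * b * c * d * hxy - b * d * h - b * d * R.hAC
    have hx2 : x ^ 2 * (a * c - B * D) = A * C := by
      linear_combination hX + (x ^ 2 - 1) * R.hE - R.hAC - R.hBD
    have hx1 : x * y * √(a * c * (a * c - B * D)) = A * C := by
      rw [← sq_eq_sq₀ (by positivity) (by positivity), mul_pow, mul_pow,
        Real.sq_sqrt (by positivity)]
      linear_combination (y ^ 2 * (a * c)) * hx2 + A * C * h
    refine ⟨?_, ?_, ?_⟩
    · rw [div_sub_one (by positivity), eq_div_iff (by positivity)]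
      linear_combination -(a * c) * hxy + h
    · rw [eq_div_iff (by positivity), hx1]
    · rw [eq_div_iff hE.ne']
      linear_combination hX + (x ^ 2 - 1) * R.hE

end SineRelations

/-! ### The parametrizations of the opposite and adjacent relations -/

section

variable {α β γ δ : ℝ} (h : IsSectorAngles α β γ δ) (hell : IsElliptic α β γ δ)
include h hell

lemma ampX_sq_eq : ampX α β γ δ ^ 2 = ((-(sin (semi α β γ δ) * sin (semi α β γ δ - α - β))
    / (sin (semi α β γ δ - α) * sin (semi α β γ δ - β)) : ℝ) : ℂ) := by
  rw [ampX, csqrt_sq, (h.sineRelations hell).amp_x]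

lemma ampY_sq_eq : ampY α β γ δ ^ 2 = ((sin (semi α β γ δ) * sin (semi α β γ δ - α - δ)
    / (sin (semi α β γ δ - β) * sin (semi α β γ δ - γ)) : ℝ) : ℂ) := by
  rw [ampY, ampX, csqrt_sq, semi_rotate, (h.sineRelations hell).amp_y]

lemma ampZ_sq_eq : ampZ α β γ δ ^ 2 = ((sin (semi α β γ δ) * sin (semi α β γ δ - α - β)
    / (sin (semi α β γ δ - γ) * sin (semi α β γ δ - δ)) : ℝ) : ℂ) := by
  rw [ampZ, ampX, csqrt_sq, semi_rotate, semi_rotate, (h.sineRelations hell).amp_z]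

lemma ampX_ne_zero : ampX α β γ δ ≠ 0 := by
  have R := h.sineRelations hell
  rw [← pow_ne_zero_iff two_ne_zero, ampX_sq_eq h hell, Complex.ofReal_ne_zero]
  exact div_ne_zero (neg_ne_zero.2 (mul_ne_zero R.hs R.hu)) (mul_pos R.ha R.hb).ne'

lemma ampY_ne_zero : ampY α β γ δ ≠ 0 := by
  have R := h.sineRelations hell
  rw [← pow_ne_zero_iff two_ne_zero, ampY_sq_eq h hell, Complex.ofReal_ne_zero]
  exact div_ne_zero (mul_ne_zero R.hs R.hw) (mul_pos R.hb R.hc).ne'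

lemma ampZ_ne_zero : ampZ α β γ δ ≠ 0 := by
  have R := h.sineRelations hell
  rw [← pow_ne_zero_iff two_ne_zero, ampZ_sq_eq h hell, Complex.ofReal_ne_zero]
  exact div_ne_zero (mul_ne_zero R.hs R.hu) (mul_pos R.hc R.hd).ne'

lemma ratioM_sub_one : ratioM α β γ δ - 1
    = -(sin (semi α β γ δ) * sin (semi α β γ δ - α - β) * sin (semi α β γ δ - α - γ)
        * sin (semi α β γ δ - α - δ))
      / (sin (semi α β γ δ - α) * sin (semi α β γ δ - β) * sin (semi α β γ δ - γ)
        * sin (semi α β γ δ - δ)) :=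
  (h.sineRelations hell).ratio_sub_one

lemma ratioM_pos_and_ne_one : 0 < ratioM α β γ δ ∧ ratioM α β γ δ ≠ 1 := by
  have R := h.sineRelations hell
  have hden := mul_pos (mul_pos (mul_pos R.ha R.hb) R.hc) R.hd
  refine ⟨div_pos (mul_pos (mul_pos (mul_pos R.hA R.hB) R.hC) R.hD) hden, ?_⟩
  rw [← sub_ne_zero, ratioM_sub_one h hell]
  exact div_ne_zero
    (neg_ne_zero.2 (mul_ne_zero (mul_ne_zero (mul_ne_zero R.hs R.hu) R.hv) R.hw)) hden.ne'

/-- The polynomial of the opposite relation is a multiple of the normalized form. -/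
lemma oppositePoly_eq (x z : ℂ) : oppositePoly α β γ δ x z
    = ((-(sin (semi α β γ δ) * sin (semi α β γ δ - α - β)) : ℝ) : ℂ)
      * oppositeForm α β γ δ x z := by
  have R := h.sineRelations hell
  have hM := congrArg (fun r : ℝ => (r : ℂ)) (ratioM_sub_one h hell)
  obtain ⟨t1, -, -⟩ := semi_sub_eq α β γ δ
  rw [oppositePoly, oppositeForm, ampX_sq_eq h hell, ampZ_sq_eq h hell, g22, g20, g02, g00, t1,
    sin_neg]
  have ha := Complex.ofReal_ne_zero.2 R.ha.ne'
  have hb := Complex.ofReal_ne_zero.2 R.hb.ne'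
  have hc := Complex.ofReal_ne_zero.2 R.hc.ne'
  have hd := Complex.ofReal_ne_zero.2 R.hd.ne'
  have hs := Complex.ofReal_ne_zero.2 R.hs
  have hu := Complex.ofReal_ne_zero.2 R.hu
  simp only [Complex.ofReal_sub, Complex.ofReal_one] at hM
  rw [hM]
  simp only [Complex.ofReal_mul, Complex.ofReal_div, Complex.ofReal_neg]
  field_simp
  ring

/-- A parametrization of the biquadratic curve with leading coefficient `M - 1` yields those of
both forms of the opposite relation. -/
lemma isParametrizedBy_opposite {k : ℝ} {φ : ℂ → ℂ} {s m : ℂ} (hm : m = ratioM α β γ δ - 1)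
    (hp : IsParametrizedBy k φ (fun u v => m * (u ^ 2 * v ^ 2) + u ^ 2 + v ^ 2 - 1) 1 1 s) :
    IsParametrizedBy k φ (oppositeForm α β γ δ) (ampX α β γ δ) (ampZ α β γ δ) s ∧
    IsParametrizedBy k φ (oppositePoly α β γ δ) (ampX α β γ δ) (ampZ α β γ δ) s := by
  have R := h.sineRelations hell
  have hform : ∀ u v, oppositeForm α β γ δ u v = 1 * (m * ((u / ampX α β γ δ) ^ 2
      * (v / ampZ α β γ δ) ^ 2) + (u / ampX α β γ δ) ^ 2 + (v / ampZ α β γ δ) ^ 2 - 1) :=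
    fun u v => by
      rw [oppositeForm, hm]
      simp only [div_pow, div_mul_div_comm, one_mul]
  refine ⟨hp.rescale (ampX_ne_zero h hell) (ampZ_ne_zero h hell) one_ne_zero hform,
    hp.rescale (ampX_ne_zero h hell) (ampZ_ne_zero h hell)
      (l := ((-(sin (semi α β γ δ) * sin (semi α β γ δ - α - β)) : ℝ) : ℂ))
      (Complex.ofReal_ne_zero.2 (neg_ne_zero.2 (mul_ne_zero R.hs R.hu))) fun u v => ?_⟩
  rw [oppositePoly_eq h hell, hform, one_mul]

lemma adjSign_eq :
    adjSign α β γ δ = if sin (semi α β γ δ - α - β) < 0 then 1 else -1 := by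
  have hσ : 2 * semi α β γ δ = α + β + γ + δ := by simp only [semi]; ring
  have hiff : γ + δ < semi α β γ δ ↔ sin (semi α β γ δ - α - β) < 0 := by
    have h1 : (0 : ℝ) ≤ sin (semi α β γ δ - α - β) ↔ semi α β γ δ ≤ γ + δ := by
      rw [((h.sineRelations hell).hu.symm).le_iff_lt, h.sin_adjacent_pos_iff]
      constructor
      · intro h; linarith
      · intro hle
        refine lt_of_le_of_ne (by linarith) fun heq => (h.sineRelations hell).hu ?_
        rw [sub_sub, ← heq, sub_self, sin_zero]
    rw [← not_le, ← not_le (a := (0 : ℝ)), h1]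
  rw [adjSign]
  simp only [hiff]

/-- The polynomial of the adjacent relation is, up to the sign of the mixed term, a multiple of
the normalized form. -/
lemma adjacentPoly_eq (huw : sin (semi α β γ δ - α - β) * sin (semi α β γ δ - α - δ) < 0)
    (x y : ℂ) : adjacentPoly α β γ δ x y
    = ((-(sin (semi α β γ δ) * sin (semi α β γ δ - α - β) * sin (semi α β γ δ - α - δ))
        / sin (semi α β γ δ - β) : ℝ) : ℂ)
      * ((adjQ α β γ δ - 1) * ((x / ampX α β γ δ) ^ 2
          * (y / (adjSign α β γ δ * ampY α β γ δ)) ^ 2)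
        + (x / ampX α β γ δ) ^ 2 + (y / (adjSign α β γ δ * ampY α β γ δ)) ^ 2 + adjC α β γ δ
        - 2 * adjB α β γ δ * ((x / ampX α β γ δ) * (y / (adjSign α β γ δ * ampY α β γ δ)))) := by
  have R := h.sineRelations hell
  obtain ⟨t1, t2, -⟩ := semi_sub_eq α β γ δ
  have ha := R.ha
  have hb := R.hb
  have hc := R.hc
  have hX := ampX_ne_zero h hell
  have hY := ampY_ne_zero h hell
  have hεsq : adjSign α β γ δ ^ 2 = 1 := by
    rw [adjSign]
    split_ifs <;> norm_num
  have hε : adjSign α β γ δ ≠ 0 := fun h0 => by simp [h0] at hεsq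
  have hE : 0 < sin (semi α β γ δ - α) * sin (semi α β γ δ - γ)
      * (sin (semi α β γ δ - α) * sin (semi α β γ δ - γ) - sin β * sin δ) := by
    rw [R.hE]
    exact mul_pos (mul_pos ha hc) (by linarith)
  have hcs : csqrt (sin (semi α β γ δ - α) * sin (semi α β γ δ - γ)
      * (sin (semi α β γ δ - α) * sin (semi α β γ δ - γ) - sin β * sin δ)) ≠ 0 := by
    rw [csqrt_of_nonneg hE.le, Complex.ofReal_ne_zero]
    exact (Real.sqrt_pos.2 hE).ne'
  -- The mixed coefficients agree by the choice of the sign.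
  have hmix : ((-(sin (semi α β γ δ) * sin (semi α β γ δ - α - β) * sin (semi α β γ δ - α - δ))
        / sin (semi α β γ δ - β) : ℝ) : ℂ)
      * (adjB α β γ δ * (x / ampX α β γ δ * (y / (adjSign α β γ δ * ampY α β γ δ))))
      = ((sin α * sin γ : ℝ) : ℂ) * x * y := by
    rw [← R.amp_mul_amp huw, ← adjSign_eq h hell, adjB]
    have hXd : csqrt (sin α * sin β / (sin (semi α β γ δ - α) * sin (semi α β γ δ - β)) - 1)
        = ampX α β γ δ := rfl
    have hYd : csqrt (sin β * sin γ / (sin (semi α β γ δ - β) * sin (semi α β γ δ - γ)) - 1)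
        = ampY α β γ δ := by rw [ampY, ampX, semi_rotate α β γ δ]
    rw [hXd, hYd]
    field_simp
  have hQ : adjQ α β γ δ - 1 = -(sin (semi α β γ δ) * sin (semi α β γ δ - α - γ))
      / (sin (semi α β γ δ - α) * sin (semi α β γ δ - γ)) := by
    rw [adjQ, R.hAC]
    field_simp
    ring
  have hC : adjC α β γ δ = sin (semi α β γ δ - β) * sin (semi α β γ δ - δ)
      / -(sin (semi α β γ δ - α - β) * sin (semi α β γ δ - α - δ)) := by
    rw [adjC, R.hE]
  have hs := Complex.ofReal_ne_zero.2 R.hs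
  have hu := Complex.ofReal_ne_zero.2 R.hu
  have hw := Complex.ofReal_ne_zero.2 R.hw
  have ha' := Complex.ofReal_ne_zero.2 ha.ne'
  have hb' := Complex.ofReal_ne_zero.2 hb.ne'
  have hc' := Complex.ofReal_ne_zero.2 hc.ne'
  have hQ' := congrArg (fun r : ℝ => (r : ℂ)) hQ
  simp only [Complex.ofReal_sub, Complex.ofReal_one] at hQ'
  have hrest : ((-(sin (semi α β γ δ) * sin (semi α β γ δ - α - β) * sin (semi α β γ δ - α - δ))
        / sin (semi α β γ δ - β) : ℝ) : ℂ)
      * ((adjQ α β γ δ - 1) * ((x / ampX α β γ δ) ^ 2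
          * (y / (adjSign α β γ δ * ampY α β γ δ)) ^ 2)
        + (x / ampX α β γ δ) ^ 2 + (y / (adjSign α β γ δ * ampY α β γ δ)) ^ 2 + adjC α β γ δ)
      = f22 α β γ δ * x ^ 2 * y ^ 2 + f20 α β γ δ * x ^ 2 + f02 α β γ δ * y ^ 2
        + f00 α β γ δ := by
    rw [div_pow, div_pow, mul_pow, hεsq, one_mul, ampX_sq_eq h hell, ampY_sq_eq h hell, hQ', hC,
      f22, f20, f02, f00, t1, t2, sin_neg, sin_neg]
    simp only [Complex.ofReal_mul, Complex.ofReal_div, Complex.ofReal_neg]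
    field_simp
    ring
  rw [adjacentPoly, f11]
  push_cast at hmix hrest ⊢
  linear_combination 2 * hmix - hrest

/-- A parametrization of the biquadratic curve with the coefficients of the normalized adjacent
relation yields those of both forms of the adjacent relation. -/
lemma isParametrizedBy_adjacent {k : ℝ} {φ : ℂ → ℂ} {s q b c : ℂ}
    (huw : sin (semi α β γ δ - α - β) * sin (semi α β γ δ - α - δ) < 0)
    (hq : q = adjQ α β γ δ - 1) (hb : b = adjB α β γ δ) (hc : c = adjC α β γ δ)
    (hp : IsParametrizedBy k φ
      (fun u v => q * (u ^ 2 * v ^ 2) + u ^ 2 + v ^ 2 + c - 2 * b * (u * v)) 1 1 s) :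
    IsParametrizedBy k φ (adjacentForm α β γ δ) (ampX α β γ δ) (ampY α β γ δ) s ∧
    IsParametrizedBy k φ (adjacentPoly α β γ δ) (ampX α β γ δ)
      (adjSign α β γ δ * ampY α β γ δ) s := by
  have R := h.sineRelations hell
  subst hq hb hc
  have hε : adjSign α β γ δ ≠ 0 := by
    rw [adjSign]
    split_ifs <;> norm_num
  refine ⟨hp.rescale (ampX_ne_zero h hell) (ampY_ne_zero h hell) one_ne_zero fun u v => ?_,
    hp.rescale (ampX_ne_zero h hell) (mul_ne_zero hε (ampY_ne_zero h hell))
      (Complex.ofReal_ne_zero.2 (div_ne_zero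
        (neg_ne_zero.2 (mul_ne_zero (mul_ne_zero R.hs R.hu) R.hw)) R.hb.ne'))
      (adjacentPoly_eq h hell huw)⟩
  rw [adjacentForm]
  simp only [div_pow, div_mul_div_comm, one_mul]

lemma adjB_eq (huw : sin (semi α β γ δ - α - β) * sin (semi α β γ δ - α - δ) < 0) :
    adjB α β γ δ = ((sin α * sin γ / √(sin (semi α β γ δ - α) * sin (semi α β γ δ - γ)
      * (sin (semi α β γ δ - α) * sin (semi α β γ δ - γ) - sin β * sin δ)) : ℝ) : ℂ) := by
  have R := h.sineRelations hell
  have hE : 0 ≤ sin (semi α β γ δ - α) * sin (semi α β γ δ - γ)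
      * (sin (semi α β γ δ - α) * sin (semi α β γ δ - γ) - sin β * sin δ) := by
    rw [R.hE]
    exact mul_nonneg (mul_pos R.ha R.hc).le (by linarith)
  rw [adjB, csqrt_of_nonneg hE, Complex.ofReal_div]

/-- The adjacent relation in terms of `cn`. -/
theorem cn_adjacent {k : ℝ} (hk : k ∈ Ioo (0 : ℝ) 1) (hkM : k ^ 2 = 1 - 1 / ratioM α β γ δ)
    (hM : 1 < ratioM α β γ δ)
    (hc : (semi α β γ δ < π ∧ α + γ < semi α β γ δ) ∨
      (π < semi α β γ δ ∧ semi α β γ δ < α + γ)) :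
    (∃! θ : ℂ, θ ∈ imagSegment k ∧ dn k θ = ((√((sin (semi α β γ δ - α)
      * sin (semi α β γ δ - γ)) / (sin α * sin γ)) : ℝ) : ℂ)) ∧
    ∀ θ ∈ imagSegment k,
      (CnPhaseEqs k α β γ δ θ ↔ dn k θ = ((√((sin (semi α β γ δ - α)
        * sin (semi α β γ δ - γ)) / (sin α * sin γ)) : ℝ) : ℂ)) ∧
      (dn k θ = ((√((sin (semi α β γ δ - α)
        * sin (semi α β γ δ - γ)) / (sin α * sin γ)) : ℝ) : ℂ) →
        IsParametrizedBy k (cn k) (adjacentForm α β γ δ) (ampX α β γ δ) (ampY α β γ δ) (-θ) ∧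
        IsParametrizedBy k (cn k) (adjacentPoly α β γ δ)
          (ampX α β γ δ) (adjSign α β γ δ * ampY α β γ δ) (-θ)) := by
  have R := h.sineRelations hell
  have hsv := h.sin_mul_sin_pos hc R.hs R.hv
  have hden := mul_pos (mul_pos (mul_pos R.ha R.hb) R.hc) R.hd
  have huw : sin (semi α β γ δ - α - β) * sin (semi α β γ δ - α - δ) < 0 := by
    have h1 := ratioM_sub_one h hell
    rw [eq_div_iff hden.ne'] at h1
    have h2 := mul_pos (sub_pos.2 hM) hden
    rw [h1] at h2
    refine neg_of_mul_neg_right ?_ hsv.le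
    linarith
  have hiff : ∀ θ ∈ imagSegment k, CnPhaseEqs k α β γ δ θ ↔ dn k θ = ((√((sin (semi α β γ δ - α)
      * sin (semi α β γ δ - γ)) / (sin α * sin γ)) : ℝ) : ℂ) := fun θ hθ => by
    obtain ⟨x, y, hx, hy, hcn, hdn, hsn, hxy⟩ := exists_pos_cn_dn_eq hk hθ
    rw [CnPhaseEqs, hcn, hdn, hsn, adjB_eq h hell huw, Complex.ofReal_inj,
      ← R.cn_phase_iff hkM huw hx hy hxy]
    simp only [adjQ, adjC]
    norm_cast
  refine ⟨existsUnique_dn_eq hk ?_, fun θ hθ => ⟨hiff θ hθ, fun hdn => ?_⟩⟩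
  · rw [Real.lt_sqrt zero_le_one, one_pow, one_lt_div (mul_pos R.hA R.hC), R.hAC]
    linarith
  · obtain ⟨h1, h2, h3⟩ := (hiff θ hθ).2 hdn
    exact isParametrizedBy_adjacent h hell huw h1 h2 h3
      (isParametrizedBy_cn_of_mem_imagSegment hk hθ)

/-- The adjacent relation in terms of `sn`. -/
theorem sn_adjacent {k : ℝ} (hk : k ∈ Ioo (0 : ℝ) 1) (hkM : k ^ 2 = 1 - ratioM α β γ δ)
    (hM : ratioM α β γ δ < 1)
    (hc : (semi α β γ δ < π ∧ semi α β γ δ < α + γ) ∨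
      (π < semi α β γ δ ∧ α + γ < semi α β γ δ)) :
    (∃! θ : ℂ, θ ∈ imagSegment k ∧ dn k θ = ((√((sin α * sin γ) / (sin (semi α β γ δ - α)
      * sin (semi α β γ δ - γ))) : ℝ) : ℂ)) ∧
    ∀ θ ∈ imagSegment k,
      (SnPhaseEqs k α β γ δ θ ↔ dn k θ = ((√((sin α * sin γ) / (sin (semi α β γ δ - α)
        * sin (semi α β γ δ - γ))) : ℝ) : ℂ)) ∧
      (dn k θ = ((√((sin α * sin γ) / (sin (semi α β γ δ - α)
        * sin (semi α β γ δ - γ))) : ℝ) : ℂ) →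
        IsParametrizedBy k (sn k) (adjacentForm α β γ δ) (ampX α β γ δ) (ampY α β γ δ) (-θ) ∧
        IsParametrizedBy k (sn k) (adjacentPoly α β γ δ)
          (ampX α β γ δ) (adjSign α β γ δ * ampY α β γ δ) (-θ)) := by
  have R := h.sineRelations hell
  have hsv := h.sin_mul_sin_neg hc R.hs R.hv
  have hden := mul_pos (mul_pos (mul_pos R.ha R.hb) R.hc) R.hd
  have huw : sin (semi α β γ δ - α - β) * sin (semi α β γ δ - α - δ) < 0 := by
    have h1 := ratioM_sub_one h hell
    rw [eq_div_iff hden.ne'] at h1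
    have h2 := mul_neg_of_neg_of_pos (sub_neg.2 hM) hden
    rw [h1] at h2
    by_contra! hle
    linarith [mul_nonpos_of_nonpos_of_nonneg hsv.le hle]
  have hiff : ∀ θ ∈ imagSegment k, SnPhaseEqs k α β γ δ θ ↔ dn k θ = ((√((sin α * sin γ)
      / (sin (semi α β γ δ - α) * sin (semi α β γ δ - γ))) : ℝ) : ℂ) := fun θ hθ => by
    obtain ⟨x, y, hx, hy, hcn, hdn, hsn, hxy⟩ := exists_pos_cn_dn_eq hk hθ
    rw [SnPhaseEqs, hcn, hdn, hsn, adjB_eq h hell huw, Complex.ofReal_inj,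
      ← R.sn_phase_iff hkM huw hx hy hxy]
    simp only [adjQ, adjC]
    norm_cast
  refine ⟨existsUnique_dn_eq hk ?_, fun θ hθ => ⟨hiff θ hθ, fun hdn => ?_⟩⟩
  · rw [Real.lt_sqrt zero_le_one, one_pow, one_lt_div (mul_pos R.ha R.hc), R.hAC]
    linarith
  · obtain ⟨h1, h2, h3⟩ := (hiff θ hθ).2 hdn
    exact isParametrizedBy_adjacent h hell huw h1 h2 h3
      (isParametrizedBy_sn_of_mem_imagSegment hk hθ)

end

end SphericalLinkage

theorem mainTheorem1 (α β γ δ : ℝ) (hang : IsSectorAngles α β γ δ)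
    (hell : IsElliptic α β γ δ)
    (σ M : ℝ) (hσ : σ = semi α β γ δ) (hM : M = ratioM α β γ δ) :
    (0 < M ∧ M ≠ 1) ∧
      -- the case `M > 1`
      (1 < M → ∀ k : ℝ, k = √(1 - 1 / M) →
        -- the opposite relation
        (∀ t : ℂ, ¬ IsPole k t → ¬ IsPole k (t + quarterPeriod k) →
          (k : ℂ) ^ 2 / (1 - (k : ℂ) ^ 2) * cn k t ^ 2 * cn k (t + quarterPeriod k) ^ 2
            + cn k t ^ 2 + cn k (t + quarterPeriod k) ^ 2 - 1 = 0) ∧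
        IsParametrizedBy k (cn k) (oppositeForm α β γ δ)
          (ampX α β γ δ) (ampZ α β γ δ) (quarterPeriod k) ∧
        IsParametrizedBy k (cn k) (oppositePoly α β γ δ)
          (ampX α β γ δ) (ampZ α β γ δ) (quarterPeriod k) ∧
        -- the adjacent relation
        (∀ t θ : ℂ, ¬ IsPole k t → ¬ IsPole k θ → ¬ IsPole k (t - θ) → dn k θ ≠ 0 →
          (k : ℂ) ^ 2 * sn k θ ^ 2 / dn k θ ^ 2 * cn k t ^ 2 * cn k (t - θ) ^ 2
            + cn k t ^ 2 - 2 * cn k θ / dn k θ ^ 2 * cn k t * cn k (t - θ)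
            + cn k (t - θ) ^ 2 + ((k : ℂ) ^ 2 - 1) * sn k θ ^ 2 / dn k θ ^ 2 = 0) ∧
        (((σ < π ∧ α + γ < σ) ∨ (π < σ ∧ σ < α + γ)) →
            (∃! θ : ℂ, θ ∈ imagSegment k ∧ dn k θ = ((√((sin (σ - α) * sin (σ - γ)) / (sin α * sin γ)) : ℝ) : ℂ)) ∧
            ∀ θ ∈ imagSegment k,
              (CnPhaseEqs k α β γ δ θ ↔ dn k θ = ((√((sin (σ - α) * sin (σ - γ)) / (sin α * sin γ)) : ℝ) : ℂ)) ∧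
              (dn k θ = ((√((sin (σ - α) * sin (σ - γ)) / (sin α * sin γ)) : ℝ) : ℂ) →
                IsParametrizedBy k (cn k) (adjacentForm α β γ δ)
                  (ampX α β γ δ) (ampY α β γ δ) (-θ) ∧
                IsParametrizedBy k (cn k) (adjacentPoly α β γ δ)
                  (ampX α β γ δ) (adjSign α β γ δ * ampY α β γ δ) (-θ))) ∧
        -- the adjacent relation after the cyclic relabelling
        (((σ < π ∧ σ < α + γ) ∨ (π < σ ∧ α + γ < σ)) →
            (∃! θ : ℂ, θ ∈ imagSegment k ∧ dn k θ = ((√((sin (σ - β) * sin (σ - δ)) / (sin β * sin δ)) : ℝ) : ℂ)) ∧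
            ∀ θ ∈ imagSegment k,
              (CnPhaseEqs k δ α β γ θ ↔ dn k θ = ((√((sin (σ - β) * sin (σ - δ)) / (sin β * sin δ)) : ℝ) : ℂ)) ∧
              (dn k θ = ((√((sin (σ - β) * sin (σ - δ)) / (sin β * sin δ)) : ℝ) : ℂ) →
                IsParametrizedBy k (cn k) (adjacentForm δ α β γ)
                  (ampX δ α β γ) (ampY δ α β γ) (-θ) ∧
                IsParametrizedBy k (cn k) (adjacentPoly δ α β γ)
                  (ampX δ α β γ) (adjSign δ α β γ * ampY δ α β γ) (-θ)))) ∧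
      -- the case `M < 1`
      (M < 1 → ∀ k : ℝ, k = √(1 - M) →
        -- the opposite relation
        (∀ t : ℂ, ¬ IsPole k t → ¬ IsPole k (t + quarterPeriod k) →
          -((k : ℂ) ^ 2 * sn k t ^ 2 * sn k (t + quarterPeriod k) ^ 2)
            + sn k t ^ 2 + sn k (t + quarterPeriod k) ^ 2 - 1 = 0) ∧
        IsParametrizedBy k (sn k) (oppositeForm α β γ δ)
          (ampX α β γ δ) (ampZ α β γ δ) (quarterPeriod k) ∧
        IsParametrizedBy k (sn k) (oppositePoly α β γ δ)
          (ampX α β γ δ) (ampZ α β γ δ) (quarterPeriod k) ∧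
        -- the adjacent relation
        (∀ t θ : ℂ, ¬ IsPole k t → ¬ IsPole k θ → ¬ IsPole k (t - θ) →
          -((k : ℂ) ^ 2 * sn k θ ^ 2 * sn k t ^ 2 * sn k (t - θ) ^ 2)
            + sn k t ^ 2 - 2 * cn k θ * dn k θ * sn k t * sn k (t - θ)
            + sn k (t - θ) ^ 2 - sn k θ ^ 2 = 0) ∧
        (((σ < π ∧ σ < α + γ) ∨ (π < σ ∧ α + γ < σ)) →
            (∃! θ : ℂ, θ ∈ imagSegment k ∧ dn k θ = ((√((sin α * sin γ) / (sin (σ - α) * sin (σ - γ))) : ℝ) : ℂ)) ∧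
            ∀ θ ∈ imagSegment k,
              (SnPhaseEqs k α β γ δ θ ↔ dn k θ = ((√((sin α * sin γ) / (sin (σ - α) * sin (σ - γ))) : ℝ) : ℂ)) ∧
              (dn k θ = ((√((sin α * sin γ) / (sin (σ - α) * sin (σ - γ))) : ℝ) : ℂ) →
                IsParametrizedBy k (sn k) (adjacentForm α β γ δ)
                  (ampX α β γ δ) (ampY α β γ δ) (-θ) ∧
                IsParametrizedBy k (sn k) (adjacentPoly α β γ δ)
                  (ampX α β γ δ) (adjSign α β γ δ * ampY α β γ δ) (-θ))) ∧
        -- the adjacent relation after the cyclic relabelling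
        (((σ < π ∧ α + γ < σ) ∨ (π < σ ∧ σ < α + γ)) →
            (∃! θ : ℂ, θ ∈ imagSegment k ∧ dn k θ = ((√((sin β * sin δ) / (sin (σ - β) * sin (σ - δ))) : ℝ) : ℂ)) ∧
            ∀ θ ∈ imagSegment k,
              (SnPhaseEqs k δ α β γ θ ↔ dn k θ = ((√((sin β * sin δ) / (sin (σ - β) * sin (σ - δ))) : ℝ) : ℂ)) ∧
              (dn k θ = ((√((sin β * sin δ) / (sin (σ - β) * sin (σ - δ))) : ℝ) : ℂ) →
                IsParametrizedBy k (sn k) (adjacentForm δ α β γ)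
                  (ampX δ α β γ) (ampY δ α β γ) (-θ) ∧
                IsParametrizedBy k (sn k) (adjacentPoly δ α β γ)
                  (ampX δ α β γ) (adjSign δ α β γ * ampY δ α β γ) (-θ)))) := by
  subst hσ hM
  have hM0 := ratioM_pos_and_ne_one hang hell
  have hrot : semi δ α β γ = semi α β γ δ := (semi_rotate δ α β γ).symm
  have hMrot : ratioM δ α β γ = ratioM α β γ δ := by
    simp only [ratioM, hrot]
    ring
  have hσ : 2 * semi α β γ δ = α + β + γ + δ := by simp only [semi]; ring
  refine ⟨hM0, fun hM k hkdef => ?_, fun hM k hkdef => ?_⟩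
  · have hinv : 1 / ratioM α β γ δ ∈ Ioo (0 : ℝ) 1 :=
      ⟨one_div_pos.2 hM0.1, (div_lt_one hM0.1).2 hM⟩
    have hk2 : k ^ 2 = 1 - 1 / ratioM α β γ δ := by
      rw [hkdef, Real.sq_sqrt (by linarith [hinv.2])]
    have hk : k ∈ Ioo (0 : ℝ) 1 := by
      rw [hkdef]
      exact ⟨Real.sqrt_pos.2 (by linarith [hinv.2]),
        (Real.sqrt_lt' one_pos).2 (by linarith [hinv.1])⟩
    have hlead : (k : ℂ) ^ 2 / (1 - (k : ℂ) ^ 2) = ratioM α β γ δ - 1 := by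
      have hne : ratioM α β γ δ ≠ 0 := hM0.1.ne'
      have hr : k ^ 2 / (1 - k ^ 2) = ratioM α β γ δ - 1 := by
        rw [hk2]
        field_simp
        ring
      exact_mod_cast hr
    have hK := isParametrizedBy_cn_quarterPeriod hk
    obtain ⟨hO, hO'⟩ := isParametrizedBy_opposite hang hell hlead hK
    refine ⟨fun t ht ht' => ?_, hO, hO', fun t θ ht hθ htθ hdn => ?_,
      cn_adjacent hang hell hk hk2 hM, fun hc => ?_⟩
    · linear_combination (hK (cn k t) (cn k (t + quarterPeriod k))).2
        ⟨t, ht, ht', (one_mul _).symm, (one_mul _).symm⟩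
    · have hn : ¬ IsPole k (-θ) := by rwa [isPole_neg hk]
      rw [sub_eq_add_neg] at htθ ⊢
      have hb := cn_biquadratic hk ht hn htθ
      rw [sn_neg hk, cn_neg hk, dn_neg hk, neg_sq] at hb
      field_simp
      linear_combination hb + cn k (t + -θ) ^ 2 * dn_sq hk hθ
        + (k : ℂ) ^ 2 * sn k θ ^ 2 * cn k (t + -θ) ^ 2 * sn_sq_add_cn_sq hk ht
    · have hr := cn_adjacent hang.rotate hell.rotate hk (by rwa [hMrot]) (by rwa [hMrot])
        (by
          rw [hrot]
          exact hc.imp (fun hc => ⟨hc.1, by linarith [hc.2]⟩)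
            fun hc => ⟨hc.1, by linarith [hc.2]⟩)
      rwa [hrot, mul_comm (sin (semi α β γ δ - δ)), mul_comm (sin δ)] at hr
  · have hk2 : k ^ 2 = 1 - ratioM α β γ δ := by
      rw [hkdef, Real.sq_sqrt (by linarith)]
    have hk : k ∈ Ioo (0 : ℝ) 1 := by
      rw [hkdef]
      exact ⟨Real.sqrt_pos.2 (by linarith), (Real.sqrt_lt' one_pos).2 (by linarith [hM0.1])⟩
    have hlead : -(k : ℂ) ^ 2 = ratioM α β γ δ - 1 := by
      have hr : -k ^ 2 = ratioM α β γ δ - 1 := by linarith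
      exact_mod_cast hr
    have hK := isParametrizedBy_sn_quarterPeriod hk
    obtain ⟨hO, hO'⟩ := isParametrizedBy_opposite hang hell hlead hK
    refine ⟨fun t ht ht' => ?_, hO, hO', fun t θ ht hθ htθ => ?_,
      sn_adjacent hang hell hk hk2 hM, fun hc => ?_⟩
    · linear_combination (hK (sn k t) (sn k (t + quarterPeriod k))).2
        ⟨t, ht, ht', (one_mul _).symm, (one_mul _).symm⟩
    · have hn : ¬ IsPole k (-θ) := by rwa [isPole_neg hk]
      rw [sub_eq_add_neg] at htθ ⊢
      have hb := sn_biquadratic hk ht hn htθ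
      rw [sn_neg hk, cn_neg hk, dn_neg hk, neg_sq] at hb
      linear_combination hb
    · have hr := sn_adjacent hang.rotate hell.rotate hk (by rwa [hMrot]) (by rwa [hMrot])
        (by
          rw [hrot]
          exact hc.imp (fun hc => ⟨hc.1, by linarith [hc.2]⟩)
            fun hc => ⟨hc.1, by linarith [hc.2]⟩)
      rwa [hrot, mul_comm (sin (semi α β γ δ - δ)), mul_comm (sin δ)] at hr
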